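/- Automata are deterministic, finite and complete. Fix notation: for an integer $b>1$ let $A_b=\{0,1,\dots,b-1\}$; an automaton over $A_b$ is $\mathcal A=\langle A_b,Q,i,\delta,F\rangle$ with $\delta:Q\times A_b\to Q$, and we write $s\cdot a=\delta(s,a)$. It is minimal if no complete automaton accepting the same language has fewer states. Its strongly connected components (s.c.c.'s) are the classes of the relation "there are paths from $s$ to $t$ and from $t$ to $s$"; an s.c.c. is non-trivial if it contains a circuit. A non-trivial s.c.c. is of type one if one of its internal transitions is labelled by a positive digit; otherwise it is of type two (it is then a simple circuit labelled only by the digit $0$). An s.c.c. $D$ is a descendant of an s.c.c. $C\neq D$ if $x\cdot a\in D$ for some $x\in C$, $a\in A_b$. For $S\subseteq\mathbb N$ and $a\in A_b$ let $\Delta(S,a)=\{n\in\mathbb N: nb+a\in S\}$, extended to words as usual, and let $\mathcal A_S$ be the automaton with states $\{\Delta(S,u):u\in A_b^*\}$, initial state $S$, transition function $\Delta$, the final states being those that contain $0$. The set $S$ is purely periodic if $S=R+p\mathbb N$ for some $p\ge1$ and $R\subseteq\{0,\dots,p-1\}$; the least such $p$ is its period. An automaton is UP-atomic if it is isomorphic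 to $\mathcal A_S$ for a purely periodic $S$ whose period is coprime with $b$. An s.c.c. $C$ is UP-atomic if no transition leaves it and, with one of its states taken as initial state, it is a UP-atomic automaton. An s.c.c. $C$ is embedded in an s.c.c. $D$ if there is $f:C\cup D\to D$ with $f(s)=s$ for $s\in D$ and $f(s\cdot a)=f(s)\cdot a$ whenever $s\in C\cup D$, $a\in A_b$ and $s\cdot a\in C\cup D$. Consider the following conditions on an automaton $\mathcal A$ over $A_b$. * (UP0) Each state and its successor by the digit $0$ are both final or both non-final. * (UP1) $\mathcal A$ is minimal and complete. * (UP2) Every type-one s.c.c. is UP-atomic. * (UP3) Every type-two s.c.c. has exactly one descendant, and that is an s.c.c. of type one. * (UP4) Every type-two s.c.c. is embedded in its descendant. Theorem. Given an integer $b>1$ and a minimal automaton $\mathcal A$ over $A_b$ with $q$ states (hence with $n=bq$ transitions), one can decide in time $O(bq)=O(n)$, in particular in time $O(b\cdot n)$, whether $\mathcal A$ satisfies Conditions (UP0)–(UP4). Precisely: there are a single program $P$ for a random access machine and a single constant $K$ such that, for every $b>1$ and every minimal automaton $\mathcal A$ over $A_b$ with state set $\{0,\dots,q-1\}$, given by $b$,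 $q$, the initial state, the table of $\delta$ and the table of the final states, $P$ always halts after at most $K\,b\,q$ elementary steps, and the content of its output register is then non-zero if and only if $\mathcal A$ satisfies (UP0)–(UP4). The elementary steps are reading or writing a register or a memory cell, tests, comparisons, addition, truncated subtraction, multiplication and Euclidean division, all on words that hold integers of value at most $(bq)^K$, that is, on words of $O(\log(bq))$ bits. -/

import Mathlib

/-! ## Automata over the digits `0, …, b - 1`, least significant digit first

Automata are Mathlib's `DFA (Fin b) Q`. Their transition function is total, so they are complete. -/

namespace UPAut

/-- `M` is minimal: no complete automaton accepting the same language has fewer states. -/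
def IsMinimal {b : ℕ} {Q : Type*} [Fintype Q] (M : DFA (Fin b) Q) : Prop :=
  ∀ (k : ℕ) (N : DFA (Fin b) (Fin k)), N.accepts = M.accepts → Fintype.card Q ≤ k

/-- Isomorphism of automata. -/
def Isomorphic {α Q Q' : Type*} (M : DFA α Q) (N : DFA α Q') : Prop :=
  ∃ e : Q ≃ Q', e M.start = N.start ∧ (∀ s a, e (M.step s a) = N.step (e s) a) ∧
    ∀ s, s ∈ M.accept ↔ e s ∈ N.accept

/-! ### Strongly connected components -/

section SCC

variable {b : ℕ} {Q : Type*} (M : DFA (Fin b) Q)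

/-- There is a (possibly empty) path from `s` to `t`. -/
def Reach (s t : Q) : Prop := ∃ u : List (Fin b), M.evalFrom s u = t

/-- `C` is a strongly connected component: a class of the relation "path from `s` to `t` and path
from `t` to `s`". -/
def IsSCC (C : Set Q) : Prop := ∃ s, C = {t | Reach M s t ∧ Reach M t s}

/-- A component is non-trivial if it contains a circuit. -/
def IsNontrivialSCC (C : Set Q) : Prop :=
  IsSCC M C ∧ ∃ s ∈ C, ∃ u : List (Fin b), u ≠ [] ∧ M.evalFrom s u = s

/-- Type one: some internal transition is labelled by a positive digit. -/
def IsTypeOne (C : Set Q) : Prop :=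
  IsNontrivialSCC M C ∧ ∃ s ∈ C, ∃ a : Fin b, 0 < (a : ℕ) ∧ M.step s a ∈ C

/-- Type two: non-trivial, with all internal transitions labelled by `0`. As every state has exactly
one successor by `0`, such a component is a simple circuit labelled by `0` only. -/
def IsTypeTwo (C : Set Q) : Prop :=
  IsNontrivialSCC M C ∧ ∀ s ∈ C, ∀ a : Fin b, M.step s a ∈ C → (a : ℕ) = 0

/-- `D` is a descendant of `C`, that is a successor of `C` in the (acyclic) component graph. -/
def IsDescendant (C D : Set Q) : Prop :=
  IsSCC M C ∧ IsSCC M D ∧ C ≠ D ∧ ∃ x ∈ C, ∃ a : Fin b, M.step x a ∈ D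

/-- `C` is embedded in `D`: there is `f : C ∪ D → D`, the identity on `D`, which commutes with the
transitions inside `C ∪ D`. (That `s · a` exists if and only if `f s · a` does is automatic for
complete automata.) Only the values of `f` on `C ∪ D` matter. -/
def IsEmbedded (C D : Set Q) : Prop :=
  ∃ f : Q → Q, (∀ s ∈ C ∪ D, f s ∈ D) ∧ (∀ s ∈ D, f s = s) ∧
    ∀ s ∈ C ∪ D, ∀ a : Fin b, M.step s a ∈ C ∪ D → f (M.step s a) = M.step (f s) a

/-- The automaton with state set `C`, initial state `i`, and the transitions and final states
of `M`. -/
def restrict (C : Set Q) (hC : ∀ s ∈ C, ∀ a : Fin b, M.step s a ∈ C) (i : C) :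
    DFA (Fin b) C where
  step s a := ⟨M.step s a, hC s s.2 a⟩
  start := i
  accept := {s | (s : Q) ∈ M.accept}

end SCC

/-! ### Purely periodic sets and their automata -/

/-- `S = R + p ℕ` for some `R ⊆ {0, …, p - 1}`, with `p` positive. -/
def HasPurePeriod (S : Set ℕ) (p : ℕ) : Prop :=
  0 < p ∧ ∃ R : Set ℕ, (∀ r ∈ R, r < p) ∧ S = {n | ∃ r ∈ R, ∃ k : ℕ, n = r + p * k}

/-- `S` is purely periodic and `p` is its period, the smallest `p` with `S = R + p ℕ`. -/
def IsPurePeriod (S : Set ℕ) (p : ℕ) : Prop := IsLeast {p' | HasPurePeriod S p'} p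

/-- `Δ(S, a) = {n | n b + a ∈ S}`. -/
def Delta {b : ℕ} (S : Set ℕ) (a : Fin b) : Set ℕ := {n | n * b + (a : ℕ) ∈ S}

/-- The automaton `𝒜_S`: its states are the sets `Δ(S, u)` for words `u`, its initial state is `S`,
its transition function is `Δ` and its final states are the sets that contain `0`. -/
def setAutomaton (b : ℕ) (S : Set ℕ) :
    DFA (Fin b) {T : Set ℕ // ∃ u : List (Fin b), u.foldl Delta S = T} where
  step T a := ⟨Delta T.1 a, by
    obtain ⟨T, u, rfl⟩ := T
    exact ⟨u ++ [a], by simp⟩⟩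
  start := ⟨S, [], rfl⟩
  accept := {T | 0 ∈ T.1}

/-- `M` is `𝒜_S` up to isomorphism, for a purely periodic `S` whose period is coprime with `b`. -/
def IsUPAtomic {b : ℕ} {Q : Type*} (M : DFA (Fin b) Q) : Prop :=
  ∃ (S : Set ℕ) (p : ℕ), IsPurePeriod S p ∧ p.Coprime b ∧ Isomorphic M (setAutomaton b S)

/-- A component is UP-atomic if no transition leaves it and it is a UP-atomic automaton once one
of its states is made initial (the choice of that state does not matter). -/
def IsUPAtomicSCC {b : ℕ} {Q : Type*} (M : DFA (Fin b) Q) (C : Set Q) : Prop :=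
  ∃ (hC : ∀ s ∈ C, ∀ a : Fin b, M.step s a ∈ C) (i : C), IsUPAtomic (restrict M C hC i)

/-- Conditions (UP 0) to (UP 4). -/
structure UPConditions {b : ℕ} {Q : Type*} [Fintype Q] (M : DFA (Fin b) Q) : Prop where
  /-- Each state and its successor by `0` are both final or both non-final. -/
  up0 : ∀ (s : Q) (a : Fin b), (a : ℕ) = 0 → (s ∈ M.accept ↔ M.step s a ∈ M.accept)
  /-- `M` is minimal (and complete). -/
  up1 : IsMinimal M
  /-- Every type-one component is UP-atomic. -/
  up2 : ∀ C, IsTypeOne M C → IsUPAtomicSCC M C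
  /-- Every type-two component has exactly one descendant, and that one is of type one. -/
  up3 : ∀ C, IsTypeTwo M C → ∃ D, IsDescendant M C D ∧ IsTypeOne M D ∧
    ∀ D', IsDescendant M C D' → D' = D
  /-- Every type-two component is embedded in its descendant. -/
  up4 : ∀ C D, IsTypeTwo M C → IsDescendant M C D → IsEmbedded M C D

end UPAut

/-! ## Random access machines with bounded words

A machine has integer registers `0, 1, 2, …` and zero-initialised arrays `0, 1, 2, …` of integers
(a program mentions only finitely many of either). Programs are built from assignments, array
writes, sequences, conditionals and loops. Each elementary operation (reading a constant, a register
or an array cell, an arithmetic operation or comparison, a write, a test) takes one unit of time.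
The contents of registers and cells are words: all values are at most a bound `W`, and a computation
that would produce a larger one gets stuck. -/

namespace RAM

/-- Registers and arrays; `mem x i` is the cell of index `i` in the array `x`. -/
@[ext]
structure State where
  reg : ℕ → ℕ
  mem : ℕ → ℕ → ℕ

/-- Binary operations. -/
inductive Op
  | add | sub | mul | div | mod | lt | eq

/-- Subtraction is truncated at `0`, division is Euclidean; comparisons yield `1` (true) or `0`
(false). -/
def Op.apply : Op → ℕ → ℕ → ℕ
  | .add, m, n => m + n
  | .sub, m, n => m - n
  | .mul, m, n => m * n
  | .div, m, n => m / n
  | .mod, m, n => m % n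
  | .lt, m, n => if m < n then 1 else 0
  | .eq, m, n => if m = n then 1 else 0

/-- Expressions: constants, registers, array cells and binary operations. -/
inductive Exp
  | const (c : ℕ)
  | reg (x : ℕ)
  | get (x : ℕ) (e : Exp)
  | bin (o : Op) (e₁ e₂ : Exp)

/-- Value of an expression. -/
def Exp.val (s : State) : Exp → ℕ
  | .const c => c
  | .reg x => s.reg x
  | .get x e => s.mem x (e.val s)
  | .bin o e₁ e₂ => o.apply (e₁.val s) (e₂.val s)

/-- Time to evaluate an expression: the number of elementary operations in it. -/
def Exp.cost : Exp → ℕ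
  | .const _ => 1
  | .reg _ => 1
  | .get _ e => e.cost + 1
  | .bin _ e₁ e₂ => e₁.cost + e₂.cost + 1

/-- The evaluation of the expression yields no value above `W` (constants and results of operations
are checked; registers and cells contain words already). -/
def Exp.Fits (W : ℕ) (s : State) : Exp → Prop
  | .const c => c ≤ W
  | .reg _ => True
  | .get _ e => e.Fits W s
  | .bin o e₁ e₂ => e₁.Fits W s ∧ e₂.Fits W s ∧ o.apply (e₁.val s) (e₂.val s) ≤ W

/-- Programs. -/
inductive Prog
  | skip
  | assign (x : ℕ) (e : Exp)
  | store (x : ℕ) (i e : Exp)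
  | seq (P₁ P₂ : Prog)
  | ite (e : Exp) (P₁ P₂ : Prog)
  | while (e : Exp) (P : Prog)

/-- `Exec W P s t s'`: started in the state `s`, with words bounded by `W`, the program `P` halts in
the state `s'` after exactly `t` units of time. Tests succeed when the value is not `0`. -/
inductive Exec (W : ℕ) : Prog → State → ℕ → State → Prop
  | skip (s : State) : Exec W .skip s 1 s
  | assign (s : State) (x : ℕ) (e : Exp) (he : e.Fits W s) :
      Exec W (.assign x e) s (e.cost + 1)
        { reg := Function.update s.reg x (e.val s), mem := s.mem }
  | store (s : State) (x : ℕ) (i e : Exp) (hi : i.Fits W s) (he : e.Fits W s) :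
      Exec W (.store x i e) s (i.cost + e.cost + 1)
        { reg := s.reg, mem := Function.update s.mem x
            (Function.update (s.mem x) (i.val s) (e.val s)) }
  | seq {P₁ P₂ : Prog} {s s₁ s₂ : State} {t₁ t₂ : ℕ}
      (h₁ : Exec W P₁ s t₁ s₁) (h₂ : Exec W P₂ s₁ t₂ s₂) :
      Exec W (.seq P₁ P₂) s (t₁ + t₂) s₂
  | ite_true {e : Exp} {P₁ P₂ : Prog} {s s₁ : State} {t : ℕ}
      (he : e.Fits W s) (hv : e.val s ≠ 0) (h : Exec W P₁ s t s₁) :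
      Exec W (.ite e P₁ P₂) s (e.cost + 1 + t) s₁
  | ite_false {e : Exp} {P₁ P₂ : Prog} {s s₁ : State} {t : ℕ}
      (he : e.Fits W s) (hv : e.val s = 0) (h : Exec W P₂ s t s₁) :
      Exec W (.ite e P₁ P₂) s (e.cost + 1 + t) s₁
  | while_true {e : Exp} {P : Prog} {s s₁ s₂ : State} {t₁ t₂ : ℕ}
      (he : e.Fits W s) (hv : e.val s ≠ 0) (h₁ : Exec W P s t₁ s₁)
      (h₂ : Exec W (.while e P) s₁ t₂ s₂) :
      Exec W (.while e P) s (e.cost + 1 + t₁ + t₂) s₂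
  | while_false {e : Exp} {P : Prog} {s : State}
      (he : e.Fits W s) (hv : e.val s = 0) :
      Exec W (.while e P) s (e.cost + 1) s

open Classical in
/-- The initial state of the machine on an automaton `M` over `b` digits with `q` states, given by
its tables: registers `0`, `1`, `2` hold `b`, `q` and the initial state; cell `s * b + a` of array
`0` holds the successor of the state `s` by the digit `a`; cell `s` of array `1` holds `1` if `s` is
final and `0` otherwise; all the rest is `0`. -/
noncomputable def input {b q : ℕ} (M : DFA (Fin b) (Fin q)) : State where
  reg x := if x = 0 then b else if x = 1 then q else if x = 2 then (M.start : ℕ) else 0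
  mem x i :=
    if x = 0 then
      if h : i / b < q ∧ i % b < b then (M.step ⟨i / b, h.1⟩ ⟨i % b, h.2⟩ : ℕ) else 0
    else if x = 1 then
      if h : i < q then (if (⟨i, h⟩ : Fin q) ∈ M.accept then 1 else 0) else 0
    else 0

end RAM

/-!
Call `z` and `o` the actions of the digits `0` and `1`. The proof replaces the conditions on strongly
connected components by conditions on single states, so that no components have to be computed.

A closed component is UP-atomic if and only if the digits act on it by permutations of the following
form: with `σ := z⁻¹ ∘ o`, which stands for the translation `S ↦ S - 1`, a digit `a` acts as
`z ∘ σ ^ a`, and `z ∘ σ ^ b = σ ∘ z` (`IsUPAtomic.exists_shift`, `isUPAtomic_restrict`). The last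
equation makes `σ` conjugate to `σ ^ b`, hence the order of `σ`, and with it the period, coprime
with `b`. Minimality ensures that distinct states stand for distinct sets.

If (UP0)-(UP4) hold, the union `T` of the components of type one is the set of states on circuits
labelled by `1`: the digit `1` permutes each component of type one, and no circuit labelled by `1`
lies elsewhere. Likewise all non-trivial components together form the set `Z` of states on circuits
labelled by `0`. A positive digit sends `Z` into `T`, and the embedding of a type-two component
into its descendant can only be `s ↦ o⁻¹ (o s)`, with `o⁻¹` computed in `T`. All this can be checked
state by state, provided that `Z` and the set `R` of the states reached from any circuit agree. On `T`
all digits then act by permutations, so that reachability is symmetric there; this yields the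
conditions on components back (`upConditions_iff_localConditions`).

Each of `Z`, `T` and `R` is the largest set in which every state has a predecessor, by the digit
`0`, by the digit `1`, by any digit. Such a set remains when states without predecessors are
removed again and again. With a queue, and a counter of incoming transitions for each state, this
takes time `O(bq)` (`RAM.peel_run`). The inverses of `z` and `o` on `T` are tabulated in time `O(q)`
(`RAM.invert_run`), and the local conditions take time `O(b)` for each state (`RAM.checkAll_run`).

Programs are verified with a program logic for total correctness with time bounds, `RAM.Run`. The
numerical constants in the time bounds are generous.
-/

/-! ### A program logic for the machine, with running times -/

namespace RAM

/-- The state with the value `v` in the register `x`. -/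
def State.setReg (s : State) (x v : ℕ) : State where
  reg := Function.update s.reg x v
  mem := s.mem

/-- The state with the value `v` in the cell `i` of the array `x`. -/
def State.setMem (s : State) (x i v : ℕ) : State where
  reg := s.reg
  mem := Function.update s.mem x (Function.update (s.mem x) i v)

@[simp] lemma State.setReg_reg (s : State) (x v y : ℕ) :
    (s.setReg x v).reg y = if y = x then v else s.reg y := by
  simp [State.setReg, Function.update_apply]

@[simp] lemma State.setReg_mem (s : State) (x v : ℕ) : (s.setReg x v).mem = s.mem := rfl

@[simp] lemma State.setMem_reg (s : State) (x i v : ℕ) : (s.setMem x i v).reg = s.reg := rfl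

@[simp] lemma State.setMem_mem (s : State) (x i v y j : ℕ) :
    (s.setMem x i v).mem y j = if y = x ∧ j = i then v else s.mem y j := by
  by_cases h : y = x
  · subst h; simp [State.setMem, Function.update_apply]
  · simp [State.setMem, h]

/-- Total correctness with a time bound: started in `s`, the program `P` halts after at most `T`
steps in a state that satisfies `Q`. -/
def Run (W : ℕ) (P : Prog) (s : State) (T : ℕ) (Q : State → Prop) : Prop :=
  ∃ t s', Exec W P s t s' ∧ t ≤ T ∧ Q s'

variable {W : ℕ} {s : State} {T T₁ T₂ : ℕ} {Q Q' : State → Prop} {P P₁ P₂ : Prog}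

lemma Run.mono (h : Run W P s T₁ Q) (hT : T₁ ≤ T₂) (hQ : ∀ s', Q s' → Q' s') :
    Run W P s T₂ Q' := by
  obtain ⟨t, s', h, ht, hs⟩ := h
  exact ⟨t, s', h, ht.trans hT, hQ _ hs⟩

lemma Run.time (h : Run W P s T₁ Q) (hT : T₁ ≤ T₂) : Run W P s T₂ Q := h.mono hT fun _ => id

lemma Run.skip (h : Q s) : Run W .skip s 1 Q := ⟨1, s, .skip s, le_rfl, h⟩

lemma Run.assign {x : ℕ} {e : Exp} (he : e.Fits W s) (h : Q (s.setReg x (e.val s))) :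
    Run W (.assign x e) s (e.cost + 1) Q := ⟨_, _, .assign s x e he, le_rfl, h⟩

lemma Run.store {x : ℕ} {i e : Exp} (hi : i.Fits W s) (he : e.Fits W s)
    (h : Q (s.setMem x (i.val s) (e.val s))) :
    Run W (.store x i e) s (i.cost + e.cost + 1) Q := ⟨_, _, .store s x i e hi he, le_rfl, h⟩

lemma Run.seq (h : Run W P₁ s T₁ fun s₁ => Run W P₂ s₁ T₂ Q) :
    Run W (.seq P₁ P₂) s (T₁ + T₂) Q := by
  obtain ⟨t, s', h, ht, t₂, s₂, h₂, ht₂, hs⟩ := h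
  exact ⟨_, _, .seq h h₂, by omega, hs⟩

lemma Run.ite {e : Exp} (he : e.Fits W s) (h₁ : e.val s ≠ 0 → Run W P₁ s T Q)
    (h₂ : e.val s = 0 → Run W P₂ s T Q) : Run W (.ite e P₁ P₂) s (e.cost + 1 + T) Q := by
  by_cases hv : e.val s = 0
  · obtain ⟨t, s', h, ht, hs⟩ := h₂ hv
    exact ⟨_, _, .ite_false he hv h, by omega, hs⟩
  · obtain ⟨t, s', h, ht, hs⟩ := h₁ hv
    exact ⟨_, _, .ite_true he hv h, by omega, hs⟩

/-- A loop whose variant `m` decreases in each round. -/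
lemma Run.while {e : Exp} (I : State → Prop) (m : State → ℕ) (hI : I s)
    (he : ∀ s, I s → e.Fits W s)
    (hstep : ∀ s, I s → e.val s ≠ 0 → Run W P s T fun s' => I s' ∧ m s' < m s)
    (hQ : ∀ s, I s → e.val s = 0 → Q s) :
    Run W (.while e P) s (m s * (T + e.cost + 1) + (e.cost + 1)) Q := by
  induction hm : m s using Nat.strong_induction_on generalizing s with
  | _ n ih =>
    by_cases hv : e.val s = 0
    · exact ⟨_, _, .while_false (he s hI) hv, by omega, hQ s hI hv⟩
    · obtain ⟨t, s', h, ht, hI', hlt⟩ := hstep s hI hv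
      obtain ⟨t₂, s₂, h₂, ht₂, hs⟩ := ih (m s') (hm ▸ hlt) hI' rfl
      refine ⟨_, _, .while_true (he s hI) hv h h₂, ?_, hs⟩
      have : (m s' + 1) * (T + e.cost + 1) ≤ n * (T + e.cost + 1) :=
        Nat.mul_le_mul_right _ (hm ▸ hlt)
      rw [Nat.add_mul] at this
      omega

/-- `for x from (its present value) to e - 1 do P`. -/
def Prog.for (x : ℕ) (e : Exp) (P : Prog) : Prog :=
  .while (.bin .lt (.reg x) e) (.seq P (.assign x (.bin .add (.reg x) (.const 1))))

lemma Run.for {x n : ℕ} {e : Exp} (I : ℕ → State → Prop) (hs : s.reg x ≤ n)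
    (hI : I (s.reg x) s) (hn : n ≤ W) (hW : 1 ≤ W)
    (he : ∀ i s, I i s → s.reg x = i → i ≤ n → e.Fits W s ∧ e.val s = n)
    (hstep : ∀ i s, I i s → s.reg x = i → i < n →
      Run W P s T fun s' => s'.reg x = i ∧ I (i + 1) (s'.setReg x (i + 1)))
    (hQ : ∀ s, I n s → s.reg x = n → Q s) :
    Run W (.for x e P) s ((n - s.reg x) * (T + e.cost + 7) + (e.cost + 3)) Q := by
  refine (Run.while (T := T + 4) (fun s => s.reg x ≤ n ∧ I (s.reg x) s) (fun s => n - s.reg x)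
    ⟨hs, hI⟩ ?_ ?_ ?_).time ?_
  · rintro s ⟨h, hI⟩
    refine ⟨trivial, (he _ s hI rfl h).1, ?_⟩
    simp only [Op.apply]
    split_ifs <;> omega
  · rintro s ⟨h, hI⟩ hv
    have hlt : s.reg x < n := by
      simpa [Exp.val, Op.apply, (he _ s hI rfl h).2] using hv
    refine (Run.seq (T₁ := T) (T₂ := 4) ?_).time le_rfl
    refine (hstep _ s hI rfl hlt).mono le_rfl ?_
    rintro s' ⟨h', hI'⟩
    refine Run.assign ⟨trivial, hW, ?_⟩ ?_
    · simp only [Op.apply, Exp.val]; omega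
    · simp only [Exp.val, Op.apply, h', State.setReg_reg, if_true]
      exact ⟨⟨hlt, hI'⟩, by omega⟩
  · rintro s ⟨h, hI⟩ hv
    have hge : ¬ s.reg x < n := by
      simpa [Exp.val, Op.apply, (he _ s hI rfl h).2] using hv
    have : s.reg x = n := by omega
    exact hQ s (this ▸ hI) this
  · simp only [Exp.cost]
    have : T + 4 + (1 + e.cost + 1) + 1 = T + e.cost + 7 := by omega
    rw [this]
    omega

/-- Registers that a program may write. -/
def Prog.regs : Prog → List ℕ
  | .skip => []
  | .assign x _ => [x]
  | .store _ _ _ => []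
  | .seq P₁ P₂ => P₁.regs ++ P₂.regs
  | .ite _ P₁ P₂ => P₁.regs ++ P₂.regs
  | .while _ P => P.regs

/-- Arrays that a program may write. -/
def Prog.arrays : Prog → List ℕ
  | .skip => []
  | .assign _ _ => []
  | .store x _ _ => [x]
  | .seq P₁ P₂ => P₁.arrays ++ P₂.arrays
  | .ite _ P₁ P₂ => P₁.arrays ++ P₂.arrays
  | .while _ P => P.arrays

lemma Exec.reg_eq {t : ℕ} {s' : State} (h : Exec W P s t s') :
    ∀ x ∉ P.regs, s'.reg x = s.reg x := by
  induction h with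
  | skip => simp
  | assign s x e he =>
    intro y hy
    simp only [Prog.regs, List.mem_singleton] at hy
    simp [hy]
  | store => simp
  | seq _ _ ih₁ ih₂ | while_true _ _ _ _ ih₁ ih₂ =>
    intro x hx
    simp only [Prog.regs, List.mem_append, not_or] at hx
    rw [ih₂ x (by simp [Prog.regs, hx]), ih₁ x (by simp [hx])]
  | ite_true _ _ _ ih | ite_false _ _ _ ih =>
    intro x hx
    simp only [Prog.regs, List.mem_append, not_or] at hx
    exact ih x (by simp [hx])
  | while_false => simp

lemma Exec.mem_eq {t : ℕ} {s' : State} (h : Exec W P s t s') :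
    ∀ x ∉ P.arrays, s'.mem x = s.mem x := by
  induction h with
  | skip => simp
  | assign => simp
  | store s x i e hi he =>
    intro y hy
    simp only [Prog.arrays, List.mem_singleton] at hy
    simp [hy]
  | seq _ _ ih₁ ih₂ | while_true _ _ _ _ ih₁ ih₂ =>
    intro x hx
    simp only [Prog.arrays, List.mem_append, not_or] at hx
    rw [ih₂ x (by simp [Prog.arrays, hx]), ih₁ x (by simp [hx])]
  | ite_true _ _ _ ih | ite_false _ _ _ ih =>
    intro x hx
    simp only [Prog.arrays, List.mem_append, not_or] at hx
    exact ih x (by simp [hx])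
  | while_false => simp

/-- What a program does not write it leaves unchanged. -/
lemma Run.frame (h : Run W P s T Q) : Run W P s T fun s' => Q s' ∧
    (∀ x ∉ P.regs, s'.reg x = s.reg x) ∧ ∀ x ∉ P.arrays, s'.mem x = s.mem x := by
  obtain ⟨t, s', h, ht, hs⟩ := h
  exact ⟨t, s', h, ht, hs, h.reg_eq, h.mem_eq⟩

end RAM

namespace RAM

/-! ### Peeling states without predecessors -/

/-- The standing assumptions on a transition table `D` of `q` states over `b` digits, and on the
bound `W` for words. -/
structure Table (W b q : ℕ) (D : ℕ → ℕ) : Prop where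
  one_lt : 1 < b
  pos : 0 < q
  le : b * q + 2 ≤ W
  lt : ∀ i, D i < q

lemma index_lt {b q i a : ℕ} (hi : i < q) (ha : a < b) : i * b + a < b * q := by
  have : (i + 1) * b ≤ q * b := Nat.mul_le_mul_right _ hi
  rw [Nat.add_mul, Nat.mul_comm q b] at this
  omega

lemma Table.states_le {W b q : ℕ} {D : ℕ → ℕ} (h : Table W b q D) : 2 * q ≤ b * q :=
  Nat.mul_le_mul_right _ h.one_lt

lemma Table.digits_le {W b q : ℕ} {D : ℕ → ℕ} (h : Table W b q D) : b ≤ b * q :=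
  Nat.le_mul_of_pos_right _ h.pos

/-- The table is present in the state `s`. -/
structure Loaded (b q : ℕ) (D : ℕ → ℕ) (s : State) : Prop where
  digits : s.reg 0 = b
  states : s.reg 1 = q
  table : s.mem 0 = D

lemma Loaded.of_eq {b q : ℕ} {D : ℕ → ℕ} {s s' : State} (h : Loaded b q D s)
    (h₀ : s'.reg 0 = s.reg 0) (h₁ : s'.reg 1 = s.reg 1) (h₂ : s'.mem 0 = s.mem 0) :
    Loaded b q D s' := ⟨h₀.trans h.1, h₁.trans h.2, h₂.trans h.3⟩

/-- Each element of `B` has a predecessor in `B` by a digit between `lo` and `hi - 1`. -/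
def Backward (b q : ℕ) (D : ℕ → ℕ) (lo hi : ℕ) (B : Set ℕ) : Prop :=
  ∀ t ∈ B, t < q ∧ ∃ s ∈ B, ∃ a, lo ≤ a ∧ a < hi ∧ D (s * b + a) = t

/-- The number of transitions in `U`, given as pairs of a state and a digit, that end in `t`. -/
def inDeg (b : ℕ) (D : ℕ → ℕ) (U : Finset (ℕ × ℕ)) (t : ℕ) : ℕ :=
  (U.filter fun e => D (e.1 * b + e.2) = t).card

lemma inDeg_insert {b : ℕ} {D : ℕ → ℕ} {U : Finset (ℕ × ℕ)} {e : ℕ × ℕ} (h : e ∉ U) (t : ℕ) :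
    inDeg b D (insert e U) t = inDeg b D U t + if t = D (e.1 * b + e.2) then 1 else 0 := by
  unfold inDeg
  rw [Finset.filter_insert]
  split_ifs with h₁ h₂ h₂
  · rw [Finset.card_insert_of_notMem (by simp [h])]
  · exact absurd h₁.symm h₂
  · exact absurd h₂.symm h₁
  · rfl

lemma inDeg_mono {b : ℕ} {D : ℕ → ℕ} {U V : Finset (ℕ × ℕ)} (h : U ⊆ V) (t : ℕ) :
    inDeg b D U t ≤ inDeg b D V t := Finset.card_le_card (Finset.filter_subset_filter _ h)

/-- The successor of the state `e` by the digit `a`. -/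
def succ (e a : Exp) : Exp := .get 0 (.bin .add (.bin .mul e (.reg 0)) a)

/-- Increments the cells `X[t]` of the targets `t` of all transitions with digits between the
contents of the registers `8` (included) and `9` (excluded). -/
def countEdges (X : ℕ) : Prog :=
  .seq (.assign 3 (.const 0))
    (.for 3 (.reg 1) (.seq (.assign 4 (.reg 8)) (.for 4 (.reg 9)
      (.seq (.assign 5 (succ (.reg 3) (.reg 4)))
        (.store X (.reg 5) (.bin .add (.get X (.reg 5)) (.const 1)))))))

/-- Appends the content of the register `x` to the queue, which is kept in the array `5`, up to the
cell whose index is in the register `7` (excluded). -/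
def push (x : ℕ) : Prog :=
  .seq (.store 5 (.reg 7) (.reg x)) (.assign 7 (.bin .add (.reg 7) (.const 1)))

/-- Puts the states `t` with `X[t] = 0` into the queue. -/
def initQueue (X : ℕ) : Prog :=
  .seq (.assign 7 (.const 0)) (.seq (.assign 3 (.const 0))
    (.for 3 (.reg 1) (.ite (.get X (.reg 3)) .skip (push 3))))

/-- Removes the transitions that start in the states in the queue, and puts every state whose last
incoming transition disappears into the queue. The register `6` points to the front. -/
def peelQueue (X : ℕ) : Prog :=
  .seq (.assign 6 (.const 0))
    (.while (.bin .lt (.reg 6) (.reg 7))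
      (.seq (.assign 3 (.get 5 (.reg 6))) (.seq (.assign 6 (.bin .add (.reg 6) (.const 1)))
        (.seq (.assign 4 (.reg 8)) (.for 4 (.reg 9)
          (.seq (.assign 5 (succ (.reg 3) (.reg 4)))
            (.seq (.store X (.reg 5) (.bin .sub (.get X (.reg 5)) (.const 1)))
              (.ite (.get X (.reg 5)) .skip (push 5)))))))))

/-- Computes, in the array `X`, positive numbers for exactly the states in the largest set each of
whose elements has a predecessor in the set, by a digit from `lo` to `hi - 1`. -/
def peel (X : ℕ) (lo hi : Exp) : Prog :=
  .seq (.assign 8 lo) (.seq (.assign 9 hi)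
    (.seq (countEdges X) (.seq (initQueue X) (peelQueue X))))

section

variable {W b q lo hi X : ℕ} {D : ℕ → ℕ} {s : State}

lemma succ_fits (h : Table W b q D) (hs : Loaded b q D s) {e a : Exp} (he : e.Fits W s)
    (ha : a.Fits W s) (he' : e.val s < q) (ha' : a.val s < b) : (succ e a).Fits W s := by
  have := index_lt he' ha'
  have := h.le
  have h0 := hs.digits
  simp only [succ, Exp.Fits, Exp.val, Op.apply, he, ha, h0, true_and]
  omega

lemma succ_val (hs : Loaded b q D s) {e a : Exp} :
    (succ e a).val s = D (e.val s * b + a.val s) := by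
  simp [succ, Exp.val, Op.apply, hs.digits, hs.table]

lemma countEdges_run (h : Table W b q D) (hs : Loaded b q D s) (hX : X ≠ 0)
    (hlo : s.reg 8 = lo) (hhi : s.reg 9 = hi) (hlh : lo ≤ hi) (hhb : hi ≤ b)
    (h0 : ∀ t < q, s.mem X t = 0) :
    Run W (countEdges X) s (100 * (b * q)) fun s' =>
      ∀ t < q, s'.mem X t = inDeg b D (Finset.range q ×ˢ Finset.Ico lo hi) t := by
  have hW := h.le
  have hq := h.states_le
  have hb := h.digits_le
  have hb' := h.one_lt
  have hq' := h.pos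
  let J (U : Finset (ℕ × ℕ)) (s : State) : Prop :=
    Loaded b q D s ∧ s.reg 8 = lo ∧ s.reg 9 = hi ∧ ∀ t < q, s.mem X t = inDeg b D U t
  have hcard : ∀ U ⊆ Finset.range q ×ˢ Finset.Ico lo hi, ∀ t, inDeg b D U t ≤ b * q := by
    intro U hU t
    refine (Finset.card_filter_le _ _).trans ((Finset.card_le_card hU).trans ?_)
    rw [Finset.card_product, Finset.card_range, Nat.card_Ico, Nat.mul_comm]
    exact Nat.mul_le_mul_right _ (by omega)
  refine (Run.seq (T₁ := 2) (T₂ := (q * (b * 40 + 20) + 4)) ?_).time ?_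
  · refine Run.assign (by simp [Exp.Fits]) ?_
    simp only [Exp.val]
    refine (Run.for (T := b * 40 + 10) (n := q)
      (fun i s => J (Finset.range i ×ˢ Finset.Ico lo hi) s) ?_ ?_ ?_ ?_ ?_ ?_ ?_).time ?_
    · simp
    · simp only [State.setReg_reg, J, if_true]
      refine ⟨hs.of_eq ?_ ?_ ?_, ?_, ?_, ?_⟩ <;> simp +contextual [inDeg, *]
    · omega
    · omega
    · rintro i s hJ - -
      simp [Exp.Fits, Exp.val, hJ.1.states]
    · rintro i s ⟨hl, h8, h9, hm⟩ hi' hiq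
      refine (Run.seq (T₁ := 2) (T₂ := b * 40 + 4) ?_).time (by omega)
      refine Run.assign (by simp [Exp.Fits]) ?_
      simp only [Exp.val, h8]
      refine (Run.for (T := 20) (n := hi) (fun a s => s.reg 3 = i ∧
        J (Finset.range i ×ˢ Finset.Ico lo hi ∪ {i} ×ˢ Finset.Ico lo a) s ∧ lo ≤ a)
        ?_ ?_ ?_ ?_ ?_ ?_ ?_).time ?_
      · simpa using hlh
      · simp only [State.setReg_reg, J, if_true, le_refl, and_true]
        refine ⟨by simpa using hi', hl.of_eq ?_ ?_ ?_, ?_, ?_, ?_⟩ <;>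
          simp +contextual [*]
      · omega
      · omega
      · rintro a s hJ - -
        simp [Exp.Fits, Exp.val, hJ.2.1.2.2.1]
      · rintro a s ⟨h3, ⟨hl, h8, h9, hm⟩, hla⟩ ha hah
        have hD := h.lt (i * b + a)
        refine (Run.seq (T₁ := 7) (T₂ := 6) ?_).time (by omega)
        refine (Run.assign (succ_fits h hl (by trivial) (by trivial) ?_ ?_) ?_).time le_rfl
        · simpa [Exp.val, h3] using hiq
        · simpa [Exp.val, ha] using hah.trans_le hhb
        rw [succ_val hl]
        have hnot : (i, a) ∉ Finset.range i ×ˢ Finset.Ico lo hi ∪ {i} ×ˢ Finset.Ico lo a := by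
          simp
        have hins : Finset.range i ×ˢ Finset.Ico lo hi ∪ {i} ×ˢ Finset.Ico lo (a + 1) =
            insert (i, a) (Finset.range i ×ˢ Finset.Ico lo hi ∪ {i} ×ˢ Finset.Ico lo a) := by
          ext ⟨x, y⟩
          simp only [Finset.mem_union, Finset.mem_product, Finset.mem_range, Finset.mem_Ico,
            Finset.mem_singleton, Finset.mem_insert, Prod.mk.injEq]
          omega
        have hle : ∀ t, inDeg b D
            (Finset.range i ×ˢ Finset.Ico lo hi ∪ {i} ×ˢ Finset.Ico lo a) t ≤ b * q := by
          refine hcard _ ?_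
          rintro ⟨x, y⟩
          simp only [Finset.mem_union, Finset.mem_product, Finset.mem_range, Finset.mem_Ico,
            Finset.mem_singleton]
          omega
        simp only [Exp.val, h3, ha]
        refine (Run.store (by trivial) ?_ ?_).time le_rfl
        · have := hle (D (i * b + a))
          simp only [Exp.Fits, Exp.val, Op.apply, State.setReg_reg, State.setReg_mem, if_true,
            hm _ hD, true_and]
          omega
        · refine ⟨by simp [ha], by simpa using h3, ⟨hl.of_eq ?_ ?_ ?_, ?_, ?_, ?_⟩, by omega⟩
          · simp
          · simp
          · ext j; simp [hX.symm]
          · simp [h8]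
          · simp [h9]
          · intro t ht
            rw [hins, inDeg_insert hnot, ← hm t ht]
            simp only [State.setReg_mem, State.setMem_mem, Exp.val, Op.apply, State.setReg_reg,
              if_true, true_and]
            split_ifs with h' <;> simp [h']
      · rintro s ⟨h3, ⟨hl, h8, h9, hm⟩, -⟩ -
        refine ⟨h3, hl.of_eq ?_ ?_ ?_, ?_, ?_, ?_⟩
        · simp
        · simp
        · simp
        · simp [h8]
        · simp [h9]
        · intro t ht
          rw [State.setReg_mem, hm t ht]
          congr 1
          ext ⟨x, y⟩
          simp only [Finset.mem_union, Finset.mem_product, Finset.mem_range, Finset.mem_Ico,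
            Finset.mem_singleton]
          omega
      · simp only [Exp.cost]
        have : (hi - (s.setReg 4 lo).reg 4) * (20 + 1 + 7) ≤ b * 40 :=
          Nat.mul_le_mul (by omega) (by omega)
        omega
    · rintro s ⟨-, -, -, hm⟩ -
      exact hm
    · simp only [Exp.cost, State.setReg_reg, if_true]
      have : (q - 0) * (b * 40 + 10 + 1 + 7) ≤ q * (b * 40 + 20) :=
        Nat.mul_le_mul (by omega) (by omega)
      omega
  · nlinarith

/-- The state of the queue in the course of the peeling, when the transitions in `U` have been
removed: it holds, without repetition, the states `t` with `X[t] = 0`, and `X[t]` is the number of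
transitions to `t` that are left. No set in which all elements have predecessors meets it. -/
structure QueueInv (b q : ℕ) (D : ℕ → ℕ) (lo hi X : ℕ) (U : Finset (ℕ × ℕ)) (s : State) :
    Prop where
  lt : ∀ j < s.reg 7, s.mem 5 j < q
  inj : ∀ j < s.reg 7, ∀ k < s.reg 7, s.mem 5 j = s.mem 5 k → j = k
  zero : ∀ t < q, s.mem X t = 0 ↔ ∃ j < s.reg 7, s.mem 5 j = t
  count : ∀ t < q, s.mem X t + inDeg b D U t =
    inDeg b D (Finset.range q ×ˢ Finset.Ico lo hi) t
  avoid : ∀ B, Backward b q D lo hi B → ∀ j < s.reg 7, s.mem 5 j ∉ B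
  sub : U ⊆ Finset.range q ×ˢ Finset.Ico lo hi
  queued : ∀ e ∈ U, ∃ j < s.reg 7, s.mem 5 j = e.1

/-- The queue never holds more than `q` states, so its length fits into a word. -/
lemma length_le_of_injective {q n : ℕ} {f : ℕ → ℕ} (hf : ∀ j < n, f j < q)
    (hi : ∀ j < n, ∀ k < n, f j = f k → j = k) : n ≤ q := by
  have := Finset.card_le_card_of_injOn (s := Finset.range n) (t := Finset.range q) f
    (by intro j hj; simpa using hf j (by simpa using hj))
    (by intro j hj k hk; exact hi j (by simpa using hj) k (by simpa using hk))
  simpa using this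

lemma QueueInv.congr {U : Finset (ℕ × ℕ)} {s' : State} (h : QueueInv b q D lo hi X U s)
    (h7 : s'.reg 7 = s.reg 7) (h5 : s'.mem 5 = s.mem 5) (hX : s'.mem X = s.mem X) :
    QueueInv b q D lo hi X U s' := by
  obtain ⟨h₁, h₂, h₃, h₄, h₅, h₆, h₇⟩ := h
  constructor <;> simpa only [h7, h5, hX]

lemma push_run {x : ℕ} {Q : State → Prop} (h7 : s.reg 7 + 1 ≤ W)
    (hQ : Q ((s.setMem 5 (s.reg 7) (s.reg x)).setReg 7 (s.reg 7 + 1))) :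
    Run W (push x) s 7 Q := by
  refine (Run.seq (T₁ := 3) (T₂ := 4) ?_).time le_rfl
  refine (Run.store (by trivial) (by trivial) ?_).time le_rfl
  refine (Run.assign ?_ ?_).time le_rfl
  · simp only [Exp.Fits, Exp.val, Op.apply, State.setMem_reg, true_and]; omega
  · simpa [Exp.val, Op.apply] using hQ

lemma initQueue_run (h : Table W b q D) (hs : Loaded b q D s) (hX5 : X ≠ 5)
    (hm : ∀ t < q, s.mem X t = inDeg b D (Finset.range q ×ˢ Finset.Ico lo hi) t) :
    Run W (initQueue X) s (50 * (b * q)) (QueueInv b q D lo hi X ∅) := by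
  have hW := h.le
  have hq := h.states_le
  have hq' := h.pos
  refine (Run.seq (T₁ := 2) (T₂ := q * 40 + 6) ?_).time (by omega)
  refine Run.assign (by simp [Exp.Fits]) ?_
  refine (Run.seq (T₁ := 2) (T₂ := q * 40 + 4) ?_).time (by omega)
  refine Run.assign (by simp [Exp.Fits]) ?_
  simp only [Exp.val]
  refine (Run.for (T := 11) (n := q) (fun i s => s.reg 1 = q ∧
    (∀ t < q, s.mem X t = inDeg b D (Finset.range q ×ˢ Finset.Ico lo hi) t) ∧
    (∀ j < s.reg 7, s.mem 5 j < i) ∧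
    (∀ j < s.reg 7, ∀ k < s.reg 7, s.mem 5 j = s.mem 5 k → j = k) ∧
    ∀ t < i, s.mem X t = 0 ↔ ∃ j < s.reg 7, s.mem 5 j = t) ?_ ?_ ?_ ?_ ?_ ?_ ?_).time ?_
  · simp
  · simpa [hs.states] using hm
  · omega
  · omega
  · rintro i s hJ - -
    simp [Exp.Fits, Exp.val, hJ.1]
  · rintro i s ⟨h1, hm, hlt, hinj, hz⟩ h3 hiq
    refine (Run.ite (T := 7) (by trivial) ?_ ?_).time (by simp [Exp.cost])
    · intro hv
      refine (Run.skip ?_).time (by omega)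
      simp only [Exp.val, h3] at hv
      refine ⟨h3, by simpa using h1, by simpa using hm, ?_, by simpa using hinj, ?_⟩
      · intro j hj
        exact (hlt j (by simpa using hj)).trans (by omega)
      · intro t ht
        simp only [State.setReg_reg, State.setReg_mem, Nat.reduceEqDiff, if_false]
        rcases Nat.lt_succ_iff_lt_or_eq.1 ht with ht | rfl
        · exact hz t ht
        · refine ⟨fun h => absurd h hv, ?_⟩
          rintro ⟨j, hj, hjt⟩
          have := hlt j hj
          omega
    · intro hv
      have hle := length_le_of_injective (fun j hj => (hlt j hj).trans hiq) hinj
      refine push_run (by omega) ?_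
      simp only [Exp.val, h3] at hv
      refine ⟨by simpa using h3, by simpa using h1, ?_, ?_, ?_, ?_⟩
      · intro t ht
        simpa [hX5] using hm t ht
      · intro j hj
        simp only [State.setReg_reg, State.setReg_mem, State.setMem_mem, h3] at hj ⊢
        norm_num at hj ⊢
        split_ifs with hj'
        · omega
        · have := hlt j (by omega)
          omega
      · intro j hj k hk
        simp only [State.setReg_reg, State.setReg_mem, State.setMem_mem, h3] at hj hk ⊢
        norm_num at hj hk ⊢
        have h₁ := hlt j
        have h₂ := hlt k
        have h₃ := hinj j
        split_ifs with hj' hk' hk'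
        · omega
        · intro; have := h₂ (by omega); omega
        · intro; have := h₁ (by omega); omega
        · exact h₃ (by omega) k (by omega)
      · intro t ht
        simp only [State.setReg_reg, State.setReg_mem, State.setMem_mem, h3, hX5]
        norm_num
        rcases Nat.lt_succ_iff_lt_or_eq.1 ht with ht | rfl
        · rw [hz t ht]
          constructor
          · rintro ⟨j, hj, hjt⟩
            exact ⟨j, by omega, by rw [if_neg (by omega)]; exact hjt⟩
          · rintro ⟨j, hj, hjt⟩
            split_ifs at hjt with hj'
            · omega
            · exact ⟨j, by omega, hjt⟩
        · exact ⟨fun _ => ⟨s.reg 7, by omega, by simp⟩, fun _ => hv⟩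
  · rintro s ⟨-, hm, hlt, hinj, hz⟩ -
    refine ⟨hlt, hinj, hz, by simpa [inDeg] using hm, ?_, by simp, by simp⟩
    -- The initial states of the queue have no predecessors at all.
    intro B hB j hj hjB
    obtain ⟨-, s', hs', a, ha, ha', hD⟩ := hB _ hjB
    have h₁ := (hz _ (hlt j hj)).2 ⟨j, hj, rfl⟩
    rw [hm _ (hlt j hj), inDeg, Finset.card_eq_zero, Finset.filter_eq_empty_iff] at h₁
    exact h₁ (x := (s', a)) (by simpa [ha, ha'] using (hB _ hs').1) hD
  · simp only [Exp.cost, State.setReg_reg, if_true]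
    omega

/-- Removing one transition, the effect of a round of the inner loop of `peelQueue`. -/
lemma removeEdge_run (h : Table W b q D) (hs : Loaded b q D s) (hX : X ≠ 0) (hX5 : X ≠ 5)
    {U : Finset (ℕ × ℕ)} {i a : ℕ} (hU : QueueInv b q D lo hi X U s)
    (h3 : s.reg 3 = i) (h4 : s.reg 4 = a) (hla : lo ≤ a) (hah : a < hi) (hhb : hi ≤ b)
    (hi' : ∃ j < s.reg 7, s.mem 5 j = i) (hia : (i, a) ∉ U) :
    Run W (.seq (.assign 5 (succ (.reg 3) (.reg 4)))
      (.seq (.store X (.reg 5) (.bin .sub (.get X (.reg 5)) (.const 1)))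
        (.ite (.get X (.reg 5)) .skip (push 5)))) s 40 fun s' =>
      QueueInv b q D lo hi X (insert (i, a) U) s' ∧ s.reg 7 ≤ s'.reg 7 ∧
        (∀ j < s.reg 7, s'.mem 5 j = s.mem 5 j) ∧ s'.mem 0 = s.mem 0 := by
  have hW := h.le
  have hq := h.states_le
  have hq' := h.pos
  have hiq : i < q := by
    obtain ⟨j, hj, rfl⟩ := hi'
    exact hU.lt j hj
  have hD := h.lt (i * b + a)
  have hcount := hU.count _ hD
  have hmem : (i, a) ∈ Finset.range q ×ˢ Finset.Ico lo hi := by simp; omega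
  have hsub : insert (i, a) U ⊆ Finset.range q ×ˢ Finset.Ico lo hi :=
    Finset.insert_subset hmem hU.sub
  -- The transition itself has not been removed yet.
  have hpos : 0 < s.mem X (D (i * b + a)) := by
    have h₁ := inDeg_mono (b := b) (D := D) hsub (D (i * b + a))
    rw [inDeg_insert hia, if_pos rfl] at h₁
    omega
  -- As its counter is positive, the target is not in the queue.
  have hnotq : ∀ j < s.reg 7, s.mem 5 j ≠ D (i * b + a) := fun j hj hj' =>
    hpos.ne' ((hU.zero _ hD).2 ⟨j, hj, hj'⟩)
  have hnew : ∀ t < q, (s.mem X t - if t = D (i * b + a) then 1 else 0) +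
      inDeg b D (insert (i, a) U) t = inDeg b D (Finset.range q ×ˢ Finset.Ico lo hi) t := by
    intro t ht
    rw [inDeg_insert hia, ← hU.count t ht]
    simp only
    split_ifs with h' <;> [subst h'; skip] <;> omega
  have hqueued : ∀ e ∈ insert (i, a) U, ∃ j < s.reg 7, s.mem 5 j = e.1 := by
    intro e he
    rcases Finset.mem_insert.1 he with rfl | he
    · exact hi'
    · exact hU.queued e he
  have hle := length_le_of_injective hU.lt hU.inj
  refine (Run.seq (T₁ := 7) (T₂ := 20) ?_).time (by omega)
  refine (Run.assign (succ_fits h hs (by trivial) (by trivial) ?_ ?_) ?_).time le_rfl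
  · simpa [Exp.val, h3] using hiq
  · simpa [Exp.val, h4] using hah.trans_le hhb
  rw [succ_val hs]
  simp only [Exp.val, h3, h4]
  refine (Run.seq (T₁ := 6) (T₂ := 14) ?_).time (by omega)
  refine (Run.store (by trivial) ?_ ?_).time le_rfl
  · have : s.mem X (D (i * b + a)) ≤ b * q := by
      have h₁ : inDeg b D (Finset.range q ×ˢ Finset.Ico lo hi) (D (i * b + a)) ≤ _ :=
        Finset.card_filter_le _ _
      rw [Finset.card_product, Finset.card_range, Nat.card_Ico] at h₁
      have h₂ : q * (hi - lo) ≤ q * b := Nat.mul_le_mul_left _ (by omega)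
      rw [Nat.mul_comm q b] at h₂
      omega
    simp only [Exp.Fits, Exp.val, Op.apply, State.setReg_reg, State.setReg_mem, if_true, true_and]
    omega
  have hXs : ∀ t, ((s.setReg 5 (D (i * b + a))).setMem X (D (i * b + a))
      (s.mem X (D (i * b + a)) - 1)).mem X t =
        s.mem X t - if t = D (i * b + a) then 1 else 0 := by
    intro t
    simp only [State.setMem_mem, State.setReg_mem, true_and]
    split_ifs with h' <;> simp [h']
  simp only [Exp.val, Op.apply, State.setReg_reg, if_true, State.setReg_mem]
  generalize hs' : (s.setReg 5 (D (i * b + a))).setMem X (D (i * b + a))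
      (s.mem X (D (i * b + a)) - 1) = s' at hXs ⊢
  have h5' : s'.mem 5 = s.mem 5 := by
    ext j; simp [← hs', hX5.symm]
  have h0' : s'.mem 0 = s.mem 0 := by
    ext j; simp [← hs', hX.symm]
  have h7' : s'.reg 7 = s.reg 7 := by simp [← hs']
  have hr5 : s'.reg 5 = D (i * b + a) := by simp [← hs']
  refine (Run.ite (T := 7) (by trivial) ?_ ?_).time (by simp [Exp.cost])
  · intro hv
    simp only [Exp.val, hr5] at hv
    refine (Run.skip ?_).time (by omega)
    refine ⟨⟨?_, ?_, ?_, ?_, ?_, hsub, ?_⟩, h7'.ge, fun j _ => by rw [h5'], h0'⟩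
    · simpa only [h7', h5'] using hU.lt
    · simpa only [h7', h5'] using hU.inj
    · intro t ht
      rw [h7', h5', ← hU.zero t ht]
      by_cases h' : t = D (i * b + a)
      · subst h'
        exact iff_of_false hv hpos.ne'
      · simp [hXs, h']
    · simpa only [hXs] using hnew
    · simpa only [h7', h5'] using hU.avoid
    · simpa only [h7', h5'] using hqueued
  · intro hv
    simp only [Exp.val, hr5] at hv
    refine push_run (by omega) ?_
    have h5n : ∀ j, ((s'.setMem 5 (s'.reg 7) (s'.reg 5)).setReg 7 (s'.reg 7 + 1)).mem 5 j =
        if j = s.reg 7 then D (i * b + a) else s.mem 5 j := by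
      intro j; simp [h7', hr5, h5']
    have h7n : ((s'.setMem 5 (s'.reg 7) (s'.reg 5)).setReg 7 (s'.reg 7 + 1)).reg 7 =
        s.reg 7 + 1 := by simp [h7']
    have hXn : ∀ t, ((s'.setMem 5 (s'.reg 7) (s'.reg 5)).setReg 7 (s'.reg 7 + 1)).mem X t =
        s.mem X t - if t = D (i * b + a) then 1 else 0 := by
      intro t; simp [hX5, hXs]
    have h0n : ((s'.setMem 5 (s'.reg 7) (s'.reg 5)).setReg 7 (s'.reg 7 + 1)).mem 0 =
        s.mem 0 := by
      ext j; simp [h0']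
    generalize (s'.setMem 5 (s'.reg 7) (s'.reg 5)).setReg 7 (s'.reg 7 + 1) = s₂ at *
    -- A property of the cells of the longer queue is checked on the old ones and on the new one.
    have hext : ∀ (p : ℕ → ℕ → Prop), (∀ j < s.reg 7, p j (s.mem 5 j)) →
        p (s.reg 7) (D (i * b + a)) → ∀ j < s₂.reg 7, p j (s₂.mem 5 j) := by
      intro p h₁ h₂ j hj
      rw [h5n]
      split_ifs with hj'
      · exact hj' ▸ h₂
      · exact h₁ j (by omega)
    have hex : ∀ t, (∃ j < s₂.reg 7, s₂.mem 5 j = t) ↔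
        (∃ j < s.reg 7, s.mem 5 j = t) ∨ t = D (i * b + a) := by
      intro t
      constructor
      · rintro ⟨j, hj, rfl⟩
        exact hext (fun _ t => (∃ j < s.reg 7, s.mem 5 j = t) ∨ t = D (i * b + a))
          (fun j hj => .inl ⟨j, hj, rfl⟩) (.inr rfl) j hj
      · rintro (⟨j, hj, rfl⟩ | rfl)
        · exact ⟨j, by omega, by rw [h5n, if_neg (by omega)]⟩
        · exact ⟨s.reg 7, by omega, by rw [h5n, if_pos rfl]⟩
    refine ⟨⟨?_, ?_, ?_, ?_, ?_, hsub, ?_⟩, by omega, ?_, h0n⟩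
    · exact hext (fun _ t => t < q) hU.lt hD
    · refine hext (fun j t => ∀ k < s₂.reg 7, t = s₂.mem 5 k → j = k) (fun j hj => ?_) ?_
      · refine hext (fun k u => s.mem 5 j = u → j = k) (hU.inj j hj) ?_
        exact fun h' => absurd h' (hnotq j hj)
      · refine hext (fun k u => D (i * b + a) = u → s.reg 7 = k) (fun k hk h' => ?_) fun _ => rfl
        exact absurd h'.symm (hnotq k hk)
    · intro t ht
      rw [hex, ← hU.zero t ht, hXn]
      by_cases h' : t = D (i * b + a)
      · subst h'
        rw [hXs] at hv
        simpa using hv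
      · simp [h']
    · simpa only [hXn] using hnew
    · intro B hB
      refine hext (fun _ t => t ∉ B) (hU.avoid B hB) fun hB' => ?_
      -- All transitions to the new state have been removed, so they come from the queue.
      obtain ⟨-, s₁, hs₁, c, hc, hc', hDc⟩ := hB _ hB'
      have h₁ := hnew _ hD
      rw [← hXs, hv, zero_add] at h₁
      have h₂ := Finset.eq_of_subset_of_card_le (Finset.filter_subset_filter
        (fun e : ℕ × ℕ => D (e.1 * b + e.2) = D (i * b + a)) hsub) h₁.ge
      have h₃ : (s₁, c) ∈ (Finset.range q ×ˢ Finset.Ico lo hi).filter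
          fun e : ℕ × ℕ => D (e.1 * b + e.2) = D (i * b + a) := by
        simpa [hc, hc', hDc] using (hB _ hs₁).1
      rw [← h₂] at h₃
      obtain ⟨j, hj, hj'⟩ := hqueued _ (Finset.mem_filter.1 h₃).1
      exact hU.avoid B hB j hj (by rw [hj']; exact hs₁)
    · intro e he
      exact (hex _).2 (.inl (hqueued e he))
    · intro j hj
      rw [h5n, if_neg (by omega)]

lemma peelQueue_run (h : Table W b q D) (hs : Loaded b q D s) (hX : X ≠ 0) (hX5 : X ≠ 5)
    (hlo : s.reg 8 = lo) (hhi : s.reg 9 = hi) (hlh : lo ≤ hi) (hhb : hi ≤ b)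
    (hU : QueueInv b q D lo hi X ∅ s) :
    Run W (peelQueue X) s (100 * (b * q)) fun s' =>
      IsGreatest {B | Backward b q D lo hi B} {t | t < q ∧ s'.mem X t ≠ 0} := by
  classical
  have hW := h.le
  have hq := h.states_le
  have hb := h.digits_le
  have hb' := h.one_lt
  have hq' := h.pos
  let E := Finset.range q ×ˢ Finset.Ico lo hi
  refine (Run.seq (T₁ := 2) (T₂ := q * (b * 60 + 24) + 4) ?_).time (by nlinarith)
  refine Run.assign (by simp [Exp.Fits]) ?_
  simp only [Exp.val]
  -- At the head of the loop, the transitions from the states in front of `6` have been removed.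
  refine (Run.while (T := b * 60 + 20) (fun s => Loaded b q D s ∧ s.reg 8 = lo ∧ s.reg 9 = hi ∧
    s.reg 6 ≤ s.reg 7 ∧
    QueueInv b q D lo hi X (E.filter fun e => ∃ j < s.reg 6, s.mem 5 j = e.1) s)
    (fun s => q - s.reg 6) ?_ ?_ ?_ ?_).time ?_
  · refine ⟨hs.of_eq ?_ ?_ ?_, ?_, ?_, ?_, ?_⟩
    · simp
    · simp
    · simp
    · simpa using hlo
    · simpa using hhi
    · simp
    · simpa using hU.congr (s' := s.setReg 6 0) (by simp) (by simp) (by simp)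
  · rintro s -
    refine ⟨trivial, trivial, ?_⟩
    simp only [Op.apply]
    split_ifs <;> omega
  · rintro s ⟨hl, h8, h9, h67, hU⟩ hv
    have hlt : s.reg 6 < s.reg 7 := by
      by_contra hc
      exact hv (if_neg hc)
    have hle := length_le_of_injective hU.lt hU.inj
    generalize hi₀ : s.mem 5 (s.reg 6) = i
    have hiq : i < q := hi₀ ▸ hU.lt _ hlt
    generalize hQ₀ : s.mem 5 = Q₀ at *
    generalize hh₀ : s.reg 6 = h₀ at *
    generalize hU₀ : (E.filter fun e => ∃ j < h₀, Q₀ j = e.1) = U₀ at *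
    refine (Run.seq (T₁ := 3) (T₂ := b * 60 + 17) ?_).time (by omega)
    refine (Run.assign (by trivial) ?_).time le_rfl
    refine (Run.seq (T₁ := 4) (T₂ := b * 60 + 13) ?_).time (by omega)
    refine (Run.assign ?_ ?_).time le_rfl
    · simp only [Exp.Fits, Exp.val, Op.apply, State.setReg_reg, true_and]
      norm_num
      omega
    refine (Run.seq (T₁ := 2) (T₂ := b * 60 + 11) ?_).time (by omega)
    refine Run.assign (by trivial) ?_
    simp only [Exp.val, Op.apply, hQ₀, hh₀, hi₀, State.setReg_reg, h8]
    norm_num only [if_true, if_false]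
    -- Within a round, the transitions from `i` by digits below `a` have been removed as well.
    refine (Run.for (T := 40) (n := hi) (fun a s' => Loaded b q D s' ∧ s'.reg 8 = lo ∧
      s'.reg 9 = hi ∧ s'.reg 6 = h₀ + 1 ∧ s'.reg 3 = i ∧ lo ≤ a ∧ s.reg 7 ≤ s'.reg 7 ∧
      (∀ j < s.reg 7, s'.mem 5 j = Q₀ j) ∧
      QueueInv b q D lo hi X (U₀ ∪ {i} ×ˢ Finset.Ico lo a) s') ?_ ?_ ?_ ?_ ?_ ?_ ?_).time ?_
    · simpa using hlh
    · refine ⟨hl.of_eq ?_ ?_ ?_, ?_, ?_, ?_, ?_, ?_, ?_, ?_, ?_⟩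
      · simp
      · simp
      · simp
      · simpa using h8
      · simpa using h9
      · simp
      · simp
      · simp
      · simp
      · simp [hQ₀]
      · simp only [State.setReg_reg, if_true, Finset.Ico_self, Finset.product_empty,
          Finset.union_empty]
        exact hU.congr (by simp) (by simp) (by simp)
    · omega
    · omega
    · rintro a s' hJ - -
      simp [Exp.Fits, Exp.val, hJ.2.2.1]
    · rintro a s' ⟨hl', h8', h9', h6', h3', hla, h7', hQ', hU'⟩ h4' hah
      have hia : (i, a) ∉ U₀ ∪ {i} ×ˢ Finset.Ico lo a := by
        simp only [← hU₀, Finset.mem_union, Finset.mem_filter, Finset.mem_product,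
          Finset.mem_singleton, Finset.mem_Ico, not_or, lt_self_iff_false, and_false,
          not_false_iff, and_true]
        rintro ⟨-, j, hj, hji⟩
        have := hU.inj j (by omega) h₀ hlt (by simp only [hQ₀]; rw [hji, hi₀])
        omega
      have hins : U₀ ∪ {i} ×ˢ Finset.Ico lo (a + 1) =
          insert (i, a) (U₀ ∪ {i} ×ˢ Finset.Ico lo a) := by
        ext ⟨x, y⟩
        simp only [Finset.mem_union, Finset.mem_product, Finset.mem_Ico,
          Finset.mem_singleton, Finset.mem_insert, Prod.mk.injEq]
        by_cases hx : (x, y) ∈ U₀ <;> simp only [hx, true_or, or_true, false_or]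
        omega
      refine (removeEdge_run h hl' hX hX5 hU' h3' h4' hla hah hhb
        ⟨h₀, by omega, by rw [hQ' _ hlt, hi₀]⟩ hia).frame.mono le_rfl ?_
      rintro s₂ ⟨⟨hU₂, h72, hQ₂, h02⟩, hr, -⟩
      have hr' : ∀ y ∉ [5, 7], s₂.reg y = s'.reg y := by
        intro y hy
        refine hr y ?_
        simpa [Prog.regs, push] using hy
      refine ⟨?_, hl'.of_eq ?_ ?_ ?_, ?_, ?_, ?_, ?_, by omega, ?_, ?_, ?_⟩
      · rw [hr' 4 (by simp), h4']
      · simp [hr']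
      · simp [hr']
      · simpa using h02
      · simpa [hr'] using h8'
      · simpa [hr'] using h9'
      · simpa [hr'] using h6'
      · simpa [hr'] using h3'
      · simp; omega
      · intro j hj
        rw [State.setReg_mem, hQ₂ j (by omega), hQ' j hj]
      · rw [hins]
        exact hU₂.congr (by simp) (by simp) (by simp)
    · rintro s' ⟨hl', h8', h9', h6', h3', -, h7', hQ', hU'⟩ -
      refine ⟨⟨hl', h8', h9', by omega, ?_⟩, by omega⟩
      convert hU' using 1
      ext ⟨x, y⟩
      simp only [E, Finset.mem_filter, Finset.mem_union, Finset.mem_product, Finset.mem_range,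
        Finset.mem_Ico, Finset.mem_singleton, ← hU₀, h6']
      constructor
      · rintro ⟨hxy, j, hj, hjx⟩
        rw [hQ' j (by omega)] at hjx
        rcases Nat.lt_succ_iff_lt_or_eq.1 hj with hj | rfl
        · exact .inl ⟨hxy, j, hj, hjx⟩
        · exact .inr ⟨hjx.symm.trans hi₀, hxy.2⟩
      · rintro (⟨hxy, j, hj, hjx⟩ | ⟨rfl, hy⟩)
        · exact ⟨hxy, j, by omega, by rw [hQ' j (by omega), hjx]⟩
        · exact ⟨⟨hiq, hy⟩, h₀, by omega, by rw [hQ' _ hlt, hi₀]⟩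
    · simp only [Exp.cost, State.setReg_reg, if_true]
      have : (hi - lo) * (40 + 1 + 7) ≤ b * 48 := Nat.mul_le_mul (by omega) (by omega)
      omega
  · rintro s ⟨hl, h8, h9, h67, hU⟩ hv
    have h67' : s.reg 6 = s.reg 7 := by
      have : ¬ s.reg 6 < s.reg 7 := fun hc => one_ne_zero ((if_pos hc).symm.trans hv)
      omega
    rw [h67'] at hU
    refine ⟨?_, ?_⟩
    · rintro t ⟨ht, ht0⟩
      refine ⟨ht, ?_⟩
      have h₁ := hU.count t ht
      by_contra! hcon
      -- Otherwise all transitions to `t` have been removed.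
      have h₂ : inDeg b D E t ≤
          inDeg b D (E.filter fun e => ∃ j < s.reg 7, s.mem 5 j = e.1) t := by
        refine Finset.card_le_card ?_
        rintro ⟨x, y⟩ hxy
        simp only [E, Finset.mem_filter, Finset.mem_product, Finset.mem_range,
          Finset.mem_Ico] at hxy ⊢
        refine ⟨⟨hxy.1, ?_⟩, hxy.2⟩
        rw [← hU.zero x hxy.1.1]
        by_contra hx
        exact hcon x ⟨hxy.1.1, hx⟩ y hxy.1.2.1 hxy.1.2.2 hxy.2
      change _ + _ = inDeg b D E t at h₁
      omega
    · intro B hB t ht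
      refine ⟨(hB t ht).1, fun h0 => ?_⟩
      obtain ⟨j, hj, rfl⟩ := (hU.zero t (hB t ht).1).1 h0
      exact hU.avoid B hB j hj ht
  · simp only [Exp.cost, State.setReg_reg, if_true]
    have : (q - 0) * (b * 60 + 20 + (1 + 1 + 1) + 1) ≤ q * (b * 60 + 24) :=
      Nat.mul_le_mul (by omega) (by omega)
    omega

lemma peel_run (h : Table W b q D) (hs : Loaded b q D s) (hX : X ≠ 0) (hX5 : X ≠ 5)
    {elo ehi : Exp} (hlo : elo.Fits W s ∧ elo.val s = lo ∧ elo.cost = 1)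
    (hhi : ∀ n, ehi.Fits W (s.setReg 8 n) ∧ ehi.val (s.setReg 8 n) = hi ∧ ehi.cost = 1)
    (hlh : lo ≤ hi) (hhb : hi ≤ b) (h0 : ∀ t, s.mem X t = 0) :
    Run W (peel X elo ehi) s (300 * (b * q)) fun s' =>
      IsGreatest {B | Backward b q D lo hi B} {t | t < q ∧ s'.mem X t ≠ 0} ∧
      (∀ x < 3, s'.reg x = s.reg x) ∧ ∀ x, x ≠ X → x ≠ 5 → s'.mem x = s.mem x := by
  have hq := h.states_le
  have hq' := h.pos
  have main : Run W (peel X elo ehi) s (300 * (b * q)) fun s' =>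
      IsGreatest {B | Backward b q D lo hi B} {t | t < q ∧ s'.mem X t ≠ 0} := by
    refine (Run.seq (T₁ := 2) (T₂ := 250 * (b * q) + 2) ?_).time (by omega)
    refine (Run.assign hlo.1 ?_).time (by rw [hlo.2.2])
    rw [hlo.2.1]
    refine (Run.seq (T₁ := 2) (T₂ := 250 * (b * q)) ?_).time (by omega)
    refine (Run.assign (hhi _).1 ?_).time (by rw [(hhi lo).2.2])
    rw [(hhi _).2.1]
    refine (Run.seq (T₁ := 100 * (b * q)) (T₂ := 150 * (b * q)) ?_).time (by omega)
    refine (countEdges_run (lo := lo) (hi := hi) h (hs.of_eq ?_ ?_ ?_) hX ?_ ?_ hlh hhb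
      ?_).frame.mono le_rfl ?_
    · simp
    · simp
    · simp
    · simp
    · simp
    · simp [h0]
    rintro s₁ ⟨h₁, hr₁, hm₁⟩
    have hl₁ : Loaded b q D s₁ := by
      refine hs.of_eq ?_ ?_ ?_
      · rw [hr₁ _ (by simp [countEdges, Prog.for, Prog.regs])]; simp
      · rw [hr₁ _ (by simp [countEdges, Prog.for, Prog.regs])]; simp
      · rw [hm₁ _ (by simp [countEdges, Prog.for, Prog.arrays, hX.symm])]; simp
    refine (Run.seq (T₁ := 50 * (b * q)) (T₂ := 100 * (b * q)) ?_).time (by omega)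
    refine (initQueue_run h hl₁ hX5 h₁).frame.mono le_rfl ?_
    rintro s₂ ⟨h₂, hr₂, hm₂⟩
    refine peelQueue_run h (hl₁.of_eq ?_ ?_ ?_) hX hX5 ?_ ?_ hlh hhb h₂
    · rw [hr₂ _ (by simp [initQueue, push, Prog.for, Prog.regs])]
    · rw [hr₂ _ (by simp [initQueue, push, Prog.for, Prog.regs])]
    · rw [hm₂ _ (by simp [initQueue, push, Prog.for, Prog.arrays])]
    · rw [hr₂ _ (by simp [initQueue, push, Prog.for, Prog.regs]),
        hr₁ _ (by simp [countEdges, Prog.for, Prog.regs])]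
      simp
    · rw [hr₂ _ (by simp [initQueue, push, Prog.for, Prog.regs]),
        hr₁ _ (by simp [countEdges, Prog.for, Prog.regs])]
      simp
  refine main.frame.mono le_rfl ?_
  rintro s' ⟨h₁, hr, hm⟩
  refine ⟨h₁, fun x hx => hr x ?_, fun x hx hx5 => hm x ?_⟩
  · simp [peel, countEdges, initQueue, peelQueue, push, Prog.for, Prog.regs]
    omega
  · simp [peel, countEdges, initQueue, peelQueue, push, Prog.for, Prog.arrays, hx, hx5]

end

end RAM

namespace RAM

/-! ### The decision procedure -/

/-- For the states `s` with nonzero cells in the array `3`, records `s` in the array `6` at its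
successor by `0`, and in the array `7` at its successor by `1`. -/
def invert : Prog :=
  .seq (.assign 3 (.const 0)) (.for 3 (.reg 1) (.ite (.get 3 (.reg 3))
    (.seq (.store 6 (succ (.reg 3) (.const 0)) (.reg 3))
      (.store 7 (succ (.reg 3) (.const 1)) (.reg 3))) .skip))

/-- Clears the flag in the register `10` unless the expression is nonzero. -/
def require (e : Exp) : Prog := .ite e .skip (.assign 10 (.const 0))

/-- Checks that the state in the register `3` and its successor by `0` are both final or both
non-final, and that it belongs to both or to none of the sets in the arrays `4` and `2`. -/
def checkState : Prog :=
  .seq (require (.bin .eq (.get 1 (.reg 3)) (.get 1 (succ (.reg 3) (.const 0)))))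
    (require (.bin .eq (.bin .lt (.const 0) (.get 4 (.reg 3)))
      (.bin .lt (.const 0) (.get 2 (.reg 3)))))

/-- Checks the conditions on a state on a circuit labelled by `1`. In the loop over the digits, the
register `5` runs through the iterates of `σ`, that is `shift` below, at this state. -/
def checkOne : Prog :=
  .seq (require (.get 2 (.reg 3))) (.seq (require (.get 3 (succ (.reg 3) (.const 0))))
    (.seq (.assign 5 (.reg 3)) (.seq (.assign 4 (.const 0))
      (.seq (.for 4 (.reg 0)
        (.seq (require (.bin .eq (succ (.reg 3) (.reg 4)) (succ (.reg 5) (.const 0))))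
          (.assign 5 (.get 6 (succ (.reg 5) (.const 1))))))
        (require (.bin .eq (succ (.reg 5) (.const 0))
          (.get 6 (succ (succ (.reg 3) (.const 0)) (.const 1)))))))))

/-- Checks the conditions on a state on a circuit labelled by `0`, whose image under the embedding
is put into the register `5`. -/
def checkZero : Prog :=
  .seq (.assign 5 (.get 7 (succ (.reg 3) (.const 1))))
    (.seq (require (.bin .eq (.get 7 (succ (succ (.reg 3) (.const 0)) (.const 1)))
      (succ (.reg 5) (.const 0))))
      (.seq (.assign 4 (.const 1)) (.for 4 (.reg 0)
        (.seq (require (.get 3 (succ (.reg 3) (.reg 4))))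
          (require (.bin .eq (succ (.reg 5) (.reg 4)) (succ (.reg 3) (.reg 4))))))))

/-- Performs all the checks on all the states. -/
def checkAll : Prog :=
  .seq (.assign 10 (.const 1)) (.seq (.assign 3 (.const 0)) (.seq
    (.for 3 (.reg 1) (.seq checkState
      (.seq (.ite (.get 3 (.reg 3)) checkOne .skip) (.ite (.get 2 (.reg 3)) checkZero .skip))))
    (.assign 0 (.reg 10))))

/-- The decision procedure. The arrays `2`, `3` and `4` mark the states on circuits labelled by `0`,
those on circuits labelled by `1`, and those reached from any circuit. -/
def decideUP : Prog :=
  .seq (peel 2 (.const 0) (.const 1)) (.seq (peel 3 (.const 1) (.const 2))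
    (.seq (peel 4 (.const 0) (.reg 0)) (.seq invert checkAll)))

section

variable {W b q : ℕ} {D : ℕ → ℕ} {s : State}

/-- `I` inverts, on the image, the restriction of the successor function by the digit `a` to the
states in `B`. -/
def InverseOn (b q : ℕ) (D : ℕ → ℕ) (a : ℕ) (B : ℕ → Prop) (I : ℕ → ℕ) : Prop :=
  (∀ j, I j < q) ∧
    ∀ i < q, B i → B (I (D (i * b + a))) ∧ D (I (D (i * b + a)) * b + a) = D (i * b + a)

lemma invert_run (h : Table W b q D) (hs : Loaded b q D s) (h6 : ∀ j, s.mem 6 j = 0)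
    (h7 : ∀ j, s.mem 7 j = 0) :
    Run W invert s (100 * (b * q)) fun s' =>
      InverseOn b q D 0 (fun i => s.mem 3 i ≠ 0) (s'.mem 6) ∧
      InverseOn b q D 1 (fun i => s.mem 3 i ≠ 0) (s'.mem 7) := by
  have hW := h.le
  have hq := h.states_le
  have hq' := h.pos
  have hb := h.one_lt
  generalize hT : s.mem 3 = T
  refine (Run.seq (T₁ := 2) (T₂ := q * 60 + 4) ?_).time (by omega)
  refine Run.assign (by simp [Exp.Fits]) ?_
  -- The table `I` is right as far as the states below `n` are concerned. Later entries may replace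
  -- earlier ones, but only by other correct ones.
  let J (n a : ℕ) (I : ℕ → ℕ) : Prop := (∀ j, I j < q) ∧ ∀ i < n, i < q → T i ≠ 0 →
    T (I (D (i * b + a))) ≠ 0 ∧ D (I (D (i * b + a)) * b + a) = D (i * b + a)
  have hstep : ∀ {n a : ℕ} {I I' : ℕ → ℕ}, J n a I → n < q → T n ≠ 0 →
      (∀ j, I' j = if j = D (n * b + a) then n else I j) → J (n + 1) a I' := by
    intro n a I I' hJ hn hTn hI
    refine ⟨fun j => ?_, fun i hi hiq hTi => ?_⟩
    · rw [hI]
      split_ifs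
      exacts [hn, hJ.1 j]
    · rw [hI]
      split_ifs with hc
      · exact ⟨hTn, hc.symm⟩
      · refine hJ.2 i ?_ hiq hTi
        rcases Nat.lt_succ_iff_lt_or_eq.1 hi with hi | rfl
        · exact hi
        · exact absurd rfl hc
  refine (Run.for (T := 40) (n := q) (fun i s => Loaded b q D s ∧ s.mem 3 = T ∧
    J i 0 (s.mem 6) ∧ J i 1 (s.mem 7)) ?_ ?_ ?_ ?_ ?_ ?_ ?_).time ?_
  · simp [Exp.val]
  · refine ⟨hs.of_eq ?_ ?_ ?_, hT, ?_, ?_⟩ <;> simp [J, h6, h7, hq', Exp.val]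
  · omega
  · omega
  · rintro i s hJ - -
    simp [Exp.Fits, Exp.val, hJ.1.states]
  · rintro i s ⟨hl, hT', hJ0, hJ1⟩ h3 hiq
    refine (Run.ite (T := 20) (by trivial) ?_ ?_).time (by simp [Exp.cost])
    · intro hv
      simp only [Exp.val, h3, hT'] at hv
      refine (Run.seq (T₁ := 9) (T₂ := 9) ?_).time (by omega)
      refine (Run.store (succ_fits h hl (by trivial) ?_ ?_ ?_) (by trivial) ?_).time
        (by simp [succ, Exp.cost])
      · simp [Exp.Fits]
      · simpa [Exp.val, h3] using hiq
      · simp only [Exp.val]; omega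
      rw [succ_val hl]
      simp only [Exp.val, h3]
      generalize hs' : s.setMem 6 (D (i * b + 0)) i = s'
      have hl' : Loaded b q D s' := by
        refine hl.of_eq ?_ ?_ ?_
        · simp [← hs']
        · simp [← hs']
        · ext j; simp [← hs']
      have h3' : s'.reg 3 = i := by simpa [← hs'] using h3
      refine (Run.store (succ_fits h hl' (by trivial) ?_ ?_ ?_) (by trivial) ?_).time
        (by simp [succ, Exp.cost])
      · simp only [Exp.Fits]; omega
      · simpa [Exp.val, h3'] using hiq
      · simpa only [Exp.val] using hb
      rw [succ_val hl']
      simp only [Exp.val, h3']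
      refine ⟨by simpa using h3', hl'.of_eq ?_ ?_ ?_, ?_, ?_, ?_⟩
      · simp
      · simp
      · ext j; simp
      · ext j; simp [← hs', hT']
      · refine hstep hJ0 hiq hv fun j => ?_
        simp [← hs']
      · refine hstep hJ1 hiq hv fun j => ?_
        simp [← hs']
    · intro hv
      simp only [Exp.val, h3, hT'] at hv
      refine (Run.skip ?_).time (by omega)
      have hext : ∀ {a I}, J i a I → J (i + 1) a I := by
        intro a I hJ
        refine ⟨hJ.1, fun k hk hkq hTk => hJ.2 k ?_ hkq hTk⟩
        rcases Nat.lt_succ_iff_lt_or_eq.1 hk with hk | rfl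
        · exact hk
        · exact absurd hv hTk
      refine ⟨h3, hl.of_eq ?_ ?_ ?_, hT', ?_, ?_⟩
      · simp
      · simp
      · simp
      · simpa using hext hJ0
      · simpa using hext hJ1
  · rintro s ⟨-, -, hJ0, hJ1⟩ -
    exact ⟨⟨hJ0.1, fun i hi => hJ0.2 i hi hi⟩, ⟨hJ1.1, fun i hi => hJ1.2 i hi hi⟩⟩
  · simp only [Exp.cost, Exp.val, State.setReg_reg, if_true]
    omega

/-- In the course of the checks, the arrays are those of `m`, and the flag is set exactly if the
condition `c` holds. -/
structure Checked (b q : ℕ) (m : ℕ → ℕ → ℕ) (c : Prop) (s : State) : Prop where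
  digits : s.reg 0 = b
  states : s.reg 1 = q
  mem : s.mem = m
  flag : s.reg 10 ≠ 0 ↔ c

variable {m : ℕ → ℕ → ℕ} {c C : Prop} {i T : ℕ} {e : Exp} {P : Prog}

lemma Checked.loaded (h : Checked b q m c s) : Loaded b q (m 0) s :=
  ⟨h.1, h.2, congrFun h.3 0⟩

lemma Checked.setReg (h : Checked b q m c s) {x v : ℕ} (h0 : 0 ≠ x) (h1 : 1 ≠ x)
    (h10 : 10 ≠ x) : Checked b q m c (s.setReg x v) := by
  obtain ⟨h₁, h₂, h₃, h₄⟩ := h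
  constructor <;> simpa [h0, h1, h10]

lemma Checked.imp (h : Checked b q m c s) (hc : c ↔ C) : Checked b q m C s :=
  ⟨h.1, h.2, h.3, h.4.trans hc⟩

lemma require_run (h : Checked b q m c s) (he : e.Fits W s) (hT : e.cost + 3 ≤ T)
    (hC : e.val s ≠ 0 ↔ C) :
    Run W (require e) s T fun s' => Checked b q m (c ∧ C) s' ∧
      ∀ x, x ≠ 10 → s'.reg x = s.reg x := by
  refine (Run.ite (T := 2) he ?_ ?_).time (by omega)
  · intro hv
    exact (Run.skip ⟨h.imp (by simp [hC.1 hv]), fun _ _ => rfl⟩).time (by omega)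
  · intro hv
    refine (Run.assign (by simp [Exp.Fits]) ⟨⟨?_, ?_, ?_, ?_⟩, ?_⟩).time le_rfl
    · simpa using h.1
    · simpa using h.2
    · simpa using h.3
    · have : ¬ C := fun hc => hC.2 hc hv
      simp [this, Exp.val]
    · intro x hx
      simp [hx]

/-- A conditional check establishes an implication. -/
lemma Run.when (h : Checked b q m c s) (he : e.Fits W s) (hi : s.reg 3 = i)
    (hP : e.val s ≠ 0 → Run W P s T fun s' => Checked b q m (c ∧ C) s' ∧ s'.reg 3 = i)
    (hT : 1 ≤ T) : Run W (.ite e P .skip) s (e.cost + 1 + T) fun s' =>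
      Checked b q m (c ∧ (e.val s ≠ 0 → C)) s' ∧ s'.reg 3 = i := by
  refine Run.ite he (fun hv => (hP hv).mono le_rfl fun s' hs' => ⟨hs'.1.imp ?_, hs'.2⟩)
    fun hv => (Run.skip ⟨h.imp ?_, hi⟩).time hT
  · simp [hv]
  · simp [hv]

lemma eq_fits {e₁ e₂ : Exp} (h₁ : e₁.Fits W s) (h₂ : e₂.Fits W s) (hW : 1 ≤ W) :
    (Exp.bin .eq e₁ e₂).Fits W s := by
  refine ⟨h₁, h₂, ?_⟩
  simp only [Op.apply]
  split_ifs <;> omega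

lemma eq_val {e₁ e₂ : Exp} : (Exp.bin .eq e₁ e₂).val s ≠ 0 ↔ e₁.val s = e₂.val s := by
  simp [Exp.val, Op.apply]

lemma checkState_run (h : Table W b q (m 0)) (hs : Checked b q m c s) (hi : s.reg 3 = i)
    (hiq : i < q) :
    Run W checkState s 40 fun s' =>
      Checked b q m (c ∧ m 1 i = m 1 (m 0 (i * b)) ∧ (m 4 i ≠ 0 ↔ m 2 i ≠ 0)) s' ∧
        s'.reg 3 = i := by
  have hW := h.le
  have hb := h.one_lt
  refine (Run.seq (T₁ := 20) (T₂ := 20) ?_).time le_rfl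
  refine (require_run (C := m 1 i = m 1 (m 0 (i * b))) hs (eq_fits (by trivial) ?_ (by omega))
    ?_ ?_).mono le_rfl ?_
  · exact succ_fits h hs.loaded (by trivial) (by simp [Exp.Fits]) (by simpa [Exp.val, hi])
      (by simp only [Exp.val]; omega)
  · simp [succ, Exp.cost]
  · rw [eq_val]
    simp only [Exp.val, succ_val hs.loaded, hi, hs.mem, add_zero]
  rintro s₁ ⟨hs₁, hr₁⟩
  have hi₁ : s₁.reg 3 = i := by rw [hr₁ _ (by simp), hi]
  refine (require_run (C := (m 4 i ≠ 0 ↔ m 2 i ≠ 0)) hs₁ (eq_fits ?_ ?_ (by omega))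
    ?_ ?_).mono le_rfl ?_
  · refine ⟨by simp [Exp.Fits], by trivial, ?_⟩
    simp only [Op.apply]
    split_ifs <;> omega
  · refine ⟨by simp [Exp.Fits], by trivial, ?_⟩
    simp only [Op.apply]
    split_ifs <;> omega
  · simp [Exp.cost]
  · rw [eq_val]
    simp only [Exp.val, Op.apply, hi₁, hs₁.mem, Nat.pos_iff_ne_zero]
    split_ifs <;> simp [*]
  rintro s₂ ⟨hs₂, hr₂⟩
  exact ⟨hs₂.imp (and_assoc), by rw [hr₂ _ (by simp), hi₁]⟩

/-- In terms of the tables: `σ j` is the state whose successor by `0` is the successor of `j` by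
`1`. -/
def shift (b : ℕ) (m : ℕ → ℕ → ℕ) (j : ℕ) : ℕ := m 6 (m 0 (j * b + 1))

/-- In terms of the tables: the condition on the states on circuits labelled by `1`. -/
def CondOne (b : ℕ) (m : ℕ → ℕ → ℕ) (i : ℕ) : Prop :=
  m 2 i ≠ 0 ∧ m 3 (m 0 (i * b)) ≠ 0 ∧
    (∀ a < b, m 0 (i * b + a) = m 0 ((shift b m)^[a] i * b)) ∧
    m 0 ((shift b m)^[b] i * b) = shift b m (m 0 (i * b))

/-- In terms of the tables: the condition on the states on circuits labelled by `0`. -/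
def CondZero (b : ℕ) (m : ℕ → ℕ → ℕ) (i : ℕ) : Prop :=
  m 7 (m 0 (m 0 (i * b) * b + 1)) = m 0 (m 7 (m 0 (i * b + 1)) * b) ∧
    ∀ a, 1 ≤ a → a < b → m 3 (m 0 (i * b + a)) ≠ 0 ∧
      m 0 (m 7 (m 0 (i * b + 1)) * b + a) = m 0 (i * b + a)

lemma checkOne_run (h : Table W b q (m 0)) (h6 : ∀ j, m 6 j < q) (hs : Checked b q m c s)
    (hi : s.reg 3 = i) (hiq : i < q) :
    Run W checkOne s (b * 60 + 100) fun s' =>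
      Checked b q m (c ∧ CondOne b m i) s' ∧ s'.reg 3 = i := by
  have hW := h.le
  have hb := h.one_lt
  have hbq := h.digits_le
  refine (Run.seq (T₁ := 5) (T₂ := b * 60 + 90) ?_).time (by omega)
  refine (require_run (C := m 2 i ≠ 0) hs (by trivial) ?_ ?_).mono le_rfl ?_
  · simp [Exp.cost]
  · simp only [Exp.val, hi, hs.mem]
  rintro s₁ ⟨hs₁, hr₁⟩
  have hi₁ : s₁.reg 3 = i := by rw [hr₁ _ (by simp), hi]
  refine (Run.seq (T₁ := 10) (T₂ := b * 60 + 80) ?_).time (by omega)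
  refine (require_run (C := m 3 (m 0 (i * b)) ≠ 0) hs₁ ?_ ?_ ?_).mono le_rfl ?_
  · exact succ_fits h hs₁.loaded (by trivial) (by simp [Exp.Fits]) (by simpa [Exp.val, hi₁])
      (by simp only [Exp.val]; omega)
  · simp [succ, Exp.cost]
  · simp only [Exp.val, succ_val hs₁.loaded, hi₁, hs₁.mem, add_zero]
  rintro s₂ ⟨hs₂, hr₂⟩
  have hi₂ : s₂.reg 3 = i := by rw [hr₂ _ (by simp), hi₁]
  refine (Run.seq (T₁ := 2) (T₂ := b * 60 + 70) ?_).time (by omega)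
  refine Run.assign (by trivial) ?_
  refine (Run.seq (T₁ := 2) (T₂ := b * 60 + 60) ?_).time (by omega)
  refine Run.assign (by simp [Exp.Fits]) ?_
  simp only [Exp.val, hi₂]
  refine (Run.seq (T₁ := b * 60 + 4) (T₂ := 50) ?_).time (by omega)
  refine (Run.for (T := 50) (n := b) (fun k s => Checked b q m
    (((c ∧ m 2 i ≠ 0) ∧ m 3 (m 0 (i * b)) ≠ 0) ∧
      ∀ a < k, m 0 (i * b + a) = m 0 ((shift b m)^[a] i * b)) s ∧ s.reg 3 = i ∧
      s.reg 5 = (shift b m)^[k] i ∧ s.reg 5 < q) ?_ ?_ ?_ ?_ ?_ ?_ ?_).time ?_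
  · simp
  · refine ⟨((hs₂.setReg ?_ ?_ ?_).setReg ?_ ?_ ?_).imp ?_, ?_, ?_, ?_⟩ <;> simp [hi₂, hiq]
  · omega
  · omega
  · rintro k s hJ - -
    simp [Exp.Fits, Exp.val, hJ.1.digits]
  · rintro k s ⟨hs, hi, h5, h5q⟩ h4 hk
    refine (Run.seq (T₁ := 20) (T₂ := 10) ?_).time (by omega)
    refine (require_run (C := m 0 (i * b + k) = m 0 ((shift b m)^[k] i * b)) hs
      (eq_fits ?_ ?_ (by omega)) ?_ ?_).mono le_rfl ?_
    · exact succ_fits h hs.loaded (by trivial) (by trivial) (by simpa [Exp.val, hi])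
        (by simpa [Exp.val, h4])
    · exact succ_fits h hs.loaded (by trivial) (by simp [Exp.Fits]) (by simpa [Exp.val])
        (by simp only [Exp.val]; omega)
    · simp [succ, Exp.cost]
    · rw [eq_val, succ_val hs.loaded, succ_val hs.loaded]
      simp only [Exp.val, hi, h4, h5, add_zero]
    rintro s' ⟨hs', hr'⟩
    have h5' : s'.reg 5 = (shift b m)^[k] i := by rw [hr' _ (by simp), h5]
    refine (Run.assign ?_ ?_).time (by simp [succ, Exp.cost])
    · exact succ_fits h hs'.loaded (by trivial) (by simp only [Exp.Fits]; omega)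
        (by simpa [Exp.val, h5', ← h5]) (by simpa only [Exp.val])
    · simp only [Exp.val, succ_val hs'.loaded, h5', hs'.mem]
      refine ⟨?_, ((hs'.setReg ?_ ?_ ?_).setReg ?_ ?_ ?_).imp ?_, ?_, ?_, ?_⟩
      · simp [hr', h4]
      · simp
      · simp
      · simp
      · simp
      · simp
      · simp
      · rw [and_assoc (c := m 0 (i * b + k) = _)]
        refine and_congr Iff.rfl ⟨?_, fun H => ⟨fun a ha => H a (by omega), H k (by omega)⟩⟩
        rintro ⟨H, Hk⟩ a ha
        rcases Nat.lt_succ_iff_lt_or_eq.1 ha with ha | rfl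
        exacts [H a ha, Hk]
      · simp [hr', hi]
      · simp only [State.setReg_reg, Function.iterate_succ_apply']
        rfl
      · simpa using h6 _
  · rintro s' ⟨hs', hi', h5', h5q⟩ -
    have h0q : m 0 (i * b + 0) < q := h.lt _
    refine (require_run (C := m 0 ((shift b m)^[b] i * b) = shift b m (m 0 (i * b))) hs'
      (eq_fits ?_ ?_ (by omega)) ?_ ?_).mono le_rfl ?_
    · exact succ_fits h hs'.loaded (by trivial) (by simp [Exp.Fits]) (by simpa [Exp.val])
        (by simp only [Exp.val]; omega)
    · refine succ_fits h hs'.loaded ?_ (by simp only [Exp.Fits]; omega) ?_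
        (by simpa only [Exp.val])
      · exact succ_fits h hs'.loaded (by trivial) (by simp [Exp.Fits])
          (by simpa [Exp.val, hi']) (by simp only [Exp.val]; omega)
      · rw [succ_val hs'.loaded]
        simpa only [Exp.val, hi'] using h0q
    · simp [succ, Exp.cost]
    · rw [eq_val, succ_val hs'.loaded]
      simp only [Exp.val, succ_val hs'.loaded, hi', h5', add_zero, hs'.mem, shift]
    rintro s₃ ⟨hs₃, hr₃⟩
    refine ⟨hs₃.imp ?_, by rw [hr₃ _ (by simp), hi']⟩
    simp only [CondOne, and_assoc]
  · simp only [Exp.cost, State.setReg_reg, if_true]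
    omega

lemma checkZero_run (h : Table W b q (m 0)) (h7 : ∀ j, m 7 j < q) (hs : Checked b q m c s)
    (hi : s.reg 3 = i) (hiq : i < q) :
    Run W checkZero s (b * 60 + 100) fun s' =>
      Checked b q m (c ∧ CondZero b m i) s' ∧ s'.reg 3 = i := by
  have hW := h.le
  have hb := h.one_lt
  have hbq := h.digits_le
  refine (Run.seq (T₁ := 8) (T₂ := b * 60 + 70) ?_).time (by omega)
  refine (Run.assign ?_ ?_).time (by simp [succ, Exp.cost])
  · exact succ_fits h hs.loaded (by trivial) (by simp only [Exp.Fits]; omega)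
      (by simpa [Exp.val, hi]) (by simpa only [Exp.val])
  simp only [Exp.val, succ_val hs.loaded, hs.mem, hi]
  generalize hs' : s.setReg 5 (m 7 (m 0 (i * b + 1))) = s'
  have hc' : Checked b q m c s' := hs' ▸ hs.setReg (by simp) (by simp) (by simp)
  have hi' : s'.reg 3 = i := by simp [← hs', hi]
  have h5' : s'.reg 5 = m 7 (m 0 (i * b + 1)) := by simp [← hs']
  have h0q : m 0 (i * b + 0) < q := h.lt _
  refine (Run.seq (T₁ := 30) (T₂ := b * 60 + 40) ?_).time (by omega)
  refine (require_run (C := m 7 (m 0 (m 0 (i * b) * b + 1)) =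
    m 0 (m 7 (m 0 (i * b + 1)) * b)) hc' (eq_fits ?_ ?_ (by omega)) ?_ ?_).mono le_rfl ?_
  · refine succ_fits h hc'.loaded ?_ (by simp only [Exp.Fits]; omega) ?_
      (by simpa only [Exp.val])
    · exact succ_fits h hc'.loaded (by trivial) (by simp [Exp.Fits])
        (by simpa [Exp.val, hi']) (by simp only [Exp.val]; omega)
    · rw [succ_val hc'.loaded]
      simpa only [Exp.val, hi'] using h0q
  · exact succ_fits h hc'.loaded (by trivial) (by simp [Exp.Fits])
      (by simpa [Exp.val, h5'] using h7 _) (by simp only [Exp.val]; omega)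
  · simp [succ, Exp.cost]
  · rw [eq_val, succ_val hc'.loaded]
    simp only [Exp.val, succ_val hc'.loaded, hi', h5', add_zero, hc'.mem]
  rintro s₁ ⟨hs₁, hr₁⟩
  refine (Run.seq (T₁ := 2) (T₂ := b * 60 + 4) ?_).time (by omega)
  refine Run.assign (by simp only [Exp.Fits]; omega) ?_
  simp only [Exp.val]
  refine (Run.for (T := 50) (n := b) (fun k s => Checked b q m
    ((c ∧ m 7 (m 0 (m 0 (i * b) * b + 1)) = m 0 (m 7 (m 0 (i * b + 1)) * b)) ∧
      ∀ a, 1 ≤ a → a < k → m 3 (m 0 (i * b + a)) ≠ 0 ∧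
      m 0 (m 7 (m 0 (i * b + 1)) * b + a) = m 0 (i * b + a)) s ∧ s.reg 3 = i ∧
      s.reg 5 = m 7 (m 0 (i * b + 1)) ∧ 1 ≤ k) ?_ ?_ ?_ ?_ ?_ ?_ ?_).time ?_
  · simpa using hb.le
  · refine ⟨(hs₁.setReg ?_ ?_ ?_).imp ?_, ?_, ?_⟩
    · simp
    · simp
    · simp
    · simp only [State.setReg_reg, if_true]
      refine ⟨fun H => ⟨H, fun a ha ha' => by omega⟩, fun H => H.1⟩
    · simp [hr₁, hi']
    · simp [hr₁, h5']
  · omega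
  · omega
  · rintro k s hJ - -
    simp [Exp.Fits, Exp.val, hJ.1.digits]
  · rintro k s ⟨hs, hi, h5, hk1⟩ h4 hk
    refine (Run.seq (T₁ := 15) (T₂ := 20) ?_).time (by omega)
    refine (require_run (C := m 3 (m 0 (i * b + k)) ≠ 0) hs ?_ ?_ ?_).mono le_rfl ?_
    · exact succ_fits h hs.loaded (by trivial) (by trivial) (by simpa [Exp.val, hi])
        (by simpa [Exp.val, h4])
    · simp [succ, Exp.cost]
    · simp only [Exp.val, succ_val hs.loaded, hi, h4, hs.mem]
    rintro s₂ ⟨hs₂, hr₂⟩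
    have hi₂ : s₂.reg 3 = i := by rw [hr₂ _ (by simp), hi]
    have h4₂ : s₂.reg 4 = k := by rw [hr₂ _ (by simp), h4]
    have h5₂ : s₂.reg 5 = _ := (hr₂ _ (by simp)).trans h5
    refine (require_run (C := m 0 (m 7 (m 0 (i * b + 1)) * b + k) = m 0 (i * b + k)) hs₂
      (eq_fits ?_ ?_ (by omega)) ?_ ?_).mono le_rfl ?_
    · exact succ_fits h hs₂.loaded (by trivial) (by trivial)
        (by simpa [Exp.val, h5₂] using h7 _) (by simpa [Exp.val, h4₂])
    · exact succ_fits h hs₂.loaded (by trivial) (by trivial) (by simpa [Exp.val, hi₂])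
        (by simpa [Exp.val, h4₂])
    · simp [succ, Exp.cost]
    · rw [eq_val, succ_val hs₂.loaded, succ_val hs₂.loaded]
      simp only [Exp.val, hi₂, h4₂, h5₂]
    rintro s₃ ⟨hs₃, hr₃⟩
    refine ⟨by rw [hr₃ _ (by simp), h4₂], (hs₃.setReg ?_ ?_ ?_).imp ?_, ?_, ?_, by omega⟩
    · simp
    · simp
    · simp
    · rw [and_assoc, and_assoc]
      refine and_congr Iff.rfl ⟨?_, fun H => ⟨fun a ha ha' => H a ha (by omega), ?_⟩⟩
      · rintro ⟨H, Hk⟩ a ha ha'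
        rcases Nat.lt_succ_iff_lt_or_eq.1 ha' with ha' | rfl
        exacts [H a ha ha', Hk]
      · exact H k hk1 (by omega)
    · simp [hr₃, hi₂]
    · simp [hr₃, h5₂]
  · rintro s' ⟨hs', hi', -⟩ -
    refine ⟨hs'.imp ?_, hi'⟩
    simp only [CondZero, and_assoc]
  · simp only [Exp.cost, State.setReg_reg, if_true]
    have : (b - 1) * (50 + 1 + 7) ≤ b * 60 := Nat.mul_le_mul (by omega) (by omega)
    omega

lemma checkAll_run (h : Table W b q (m 0)) (h6 : ∀ j, m 6 j < q) (h7 : ∀ j, m 7 j < q)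
    (hs : Loaded b q (m 0) s) (hm : s.mem = m) :
    Run W checkAll s (300 * (b * q)) fun s' => s'.reg 0 ≠ 0 ↔ ∀ i < q,
      (m 1 i = m 1 (m 0 (i * b)) ∧ (m 4 i ≠ 0 ↔ m 2 i ≠ 0)) ∧
      (m 3 i ≠ 0 → CondOne b m i) ∧ (m 2 i ≠ 0 → CondZero b m i) := by
  have hW := h.le
  have hb := h.one_lt
  have hq := h.states_le
  have hq' := h.pos
  have hbq := h.digits_le
  refine (Run.seq (T₁ := 2) (T₂ := q * (b * 120 + 260) + 8) ?_).time ?_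
  swap
  · have : q * (b * 120 + 260) = 120 * (b * q) + 130 * (2 * q) := by ring
    omega
  refine Run.assign (by simp only [Exp.Fits]; omega) ?_
  refine (Run.seq (T₁ := 2) (T₂ := q * (b * 120 + 260) + 6) ?_).time (by omega)
  refine Run.assign (by simp [Exp.Fits]) ?_
  refine (Run.seq (T₁ := q * (b * 120 + 260) + 4) (T₂ := 2) ?_).time (by omega)
  simp only [Exp.val]
  refine (Run.for (T := b * 120 + 252) (n := q) (fun k s => Checked b q m (∀ i < k,
      (m 1 i = m 1 (m 0 (i * b)) ∧ (m 4 i ≠ 0 ↔ m 2 i ≠ 0)) ∧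
      (m 3 i ≠ 0 → CondOne b m i) ∧ (m 2 i ≠ 0 → CondZero b m i)) s)
      ?_ ?_ ?_ ?_ ?_ ?_ ?_).time ?_
  · simp
  · constructor <;> simp [hs.digits, hs.states, hm]
  · omega
  · omega
  · rintro k s hJ - -
    simp [Exp.Fits, Exp.val, hJ.states]
  · rintro k s hs hi hk
    refine (Run.seq (T₁ := 40) (T₂ := b * 120 + 210) ?_).time (by omega)
    refine (checkState_run h hs hi hk).mono le_rfl ?_
    rintro s₁ ⟨hs₁, hi₁⟩
    refine (Run.seq (T₁ := b * 60 + 103) (T₂ := b * 60 + 103) ?_).time (by omega)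
    refine (Run.when hs₁ (by trivial) hi₁ (fun _ => checkOne_run h h6 hs₁ hi₁ hk)
      (by omega)).mono (by simp only [Exp.cost]; omega) ?_
    rintro s₂ ⟨hs₂, hi₂⟩
    refine (Run.when hs₂ (by trivial) hi₂ (fun _ => checkZero_run h h7 hs₂ hi₂ hk)
      (by omega)).mono (by simp only [Exp.cost]; omega) ?_
    rintro s₃ ⟨hs₃, hi₃⟩
    simp only [Exp.val, hi₂, hi₁, hs₁.mem, hs₂.mem] at hs₃
    refine ⟨hi₃, (hs₃.setReg (by simp) (by simp) (by simp)).imp ?_⟩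
    rw [and_assoc, and_assoc]
    constructor
    · rintro ⟨H, Hk⟩ a ha
      rcases Nat.lt_succ_iff_lt_or_eq.1 ha with ha | rfl
      exacts [H a ha, Hk]
    · exact fun H => ⟨fun a ha => H a (by omega), H k (by omega)⟩
  · rintro s' hs' -
    refine (Run.assign (by trivial) ?_).time le_rfl
    simpa [Exp.val] using hs'.flag
  · simp only [Exp.cost, State.setReg_reg, if_true]
    have : (q - 0) * (b * 120 + 252 + 1 + 7) ≤ q * (b * 120 + 260) :=
      Nat.mul_le_mul (by omega) (by omega)
    exact Nat.add_le_add this le_rfl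

end

end RAM

namespace UPAut

/-! ### Minimal automata and strongly connected components -/

section SCC

variable {b : ℕ} {Q : Type*} {M : DFA (Fin b) Q}

/-- Distinct states of a minimal automaton accept distinct languages. -/
lemma IsMinimal.acceptsFrom_injective [Fintype Q] (h : IsMinimal M) :
    Function.Injective M.acceptsFrom := by
  classical
  -- The left quotients of the language are languages of states of `M`, and they are the states
  -- of an automaton that accepts it.
  have hsub : Set.range M.accepts.leftQuotient ⊆ M.acceptsFrom '' Set.univ := by
    rw [Language.leftQuotient_accepts, Set.image_univ]
    exact Set.range_comp_subset_range _ _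
  have hfin : (M.acceptsFrom '' Set.univ).Finite := Set.toFinite _
  have : Finite (Set.range M.accepts.leftQuotient) := hfin.subset hsub
  have h₁ := h _ (DFA.reindex (Finite.equivFin _) M.accepts.toDFA)
    (by rw [DFA.accepts_reindex, Language.accepts_toDFA])
  have h₂ : Nat.card (Set.range M.accepts.leftQuotient) ≤ (M.acceptsFrom '' Set.univ).ncard :=
    Set.ncard_le_ncard hsub hfin
  rw [← Set.injOn_univ]
  refine Set.injOn_of_ncard_image_eq (le_antisymm (Set.ncard_image_le) ?_)
  rw [Set.ncard_univ, Nat.card_eq_fintype_card]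
  exact h₁.trans h₂

lemma Reach.refl (s : Q) : Reach M s s := ⟨[], rfl⟩

lemma Reach.trans {s t u : Q} (h₁ : Reach M s t) (h₂ : Reach M t u) : Reach M s u := by
  obtain ⟨v, rfl⟩ := h₁
  obtain ⟨w, rfl⟩ := h₂
  exact ⟨v ++ w, M.evalFrom_of_append _ _ _⟩

lemma Reach.step (s : Q) (a : Fin b) : Reach M s (M.step s a) := ⟨[a], rfl⟩

lemma reach_iterate (a : Fin b) (n : ℕ) (s : Q) : Reach M s ((M.step · a)^[n] s) := by
  induction n with
  | zero => exact .refl s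
  | succ n ih =>
    rw [Function.iterate_succ_apply']
    exact ih.trans (.step _ a)

lemma Reach.of_closed {B : Set Q} (hB : ∀ s ∈ B, ∀ a, M.step s a ∈ B) {s t : Q}
    (h : Reach M s t) (hs : s ∈ B) : t ∈ B := by
  obtain ⟨u, rfl⟩ := h
  induction u generalizing s with
  | nil => exact hs
  | cons a u ih => exact ih (hB s hs a)

variable (M) in
/-- The strongly connected component of a state. -/
def scc (s : Q) : Set Q := {t | Reach M s t ∧ Reach M t s}

lemma mem_scc_self (s : Q) : s ∈ scc M s := ⟨.refl s, .refl s⟩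

lemma isSCC_scc (s : Q) : IsSCC M (scc M s) := ⟨s, rfl⟩

lemma scc_eq {s t : Q} (h₁ : Reach M s t) (h₂ : Reach M t s) : scc M s = scc M t := by
  ext u
  exact ⟨fun h => ⟨h₂.trans h.1, h.2.trans h₁⟩, fun h => ⟨h₁.trans h.1, h.2.trans h₂⟩⟩

lemma IsSCC.eq_scc {C : Set Q} (h : IsSCC M C) {s : Q} (hs : s ∈ C) : C = scc M s := by
  obtain ⟨t, rfl⟩ := h
  exact scc_eq hs.1 hs.2

lemma IsNontrivialSCC.exists_circuit {C : Set Q} (h : IsNontrivialSCC M C) {t : Q} (ht : t ∈ C) :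
    ∃ u : List (Fin b), u ≠ [] ∧ M.evalFrom t u = t := by
  obtain ⟨hC, s, hs, u, hu, hus⟩ := h
  rw [hC.eq_scc hs] at ht
  obtain ⟨⟨v, hv⟩, w, hw⟩ := ht
  refine ⟨w ++ u ++ v, by simp [hu], ?_⟩
  simp only [DFA.evalFrom_of_append, hw, hus, hv]

lemma IsNontrivialSCC.exists_step_mem {C : Set Q} (h : IsNontrivialSCC M C) {t : Q}
    (ht : t ∈ C) : ∃ a, M.step t a ∈ C := by
  obtain ⟨u, hu, hut⟩ := h.exists_circuit ht
  rw [h.1.eq_scc ht]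
  cases u with
  | nil => exact absurd rfl hu
  | cons a u => exact ⟨a, .step _ _, u, hut⟩

lemma IsNontrivialSCC.exists_pred_mem {C : Set Q} (h : IsNontrivialSCC M C) {t : Q}
    (ht : t ∈ C) : ∃ s ∈ C, ∃ a, M.step s a = t := by
  obtain ⟨u, hu, hut⟩ := h.exists_circuit ht
  rw [h.1.eq_scc ht]
  induction u using List.reverseRecOn with
  | nil => exact absurd rfl hu
  | append_singleton u a =>
    rw [DFA.evalFrom_of_append] at hut
    exact ⟨M.evalFrom t u, ⟨⟨u, rfl⟩, [a], hut⟩, a, hut⟩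

lemma isNontrivialSCC_of_circuit {s : Q} {u : List (Fin b)} (hu : u ≠ [])
    (hs : M.evalFrom s u = s) : IsNontrivialSCC M (scc M s) :=
  ⟨isSCC_scc s, s, mem_scc_self s, u, hu, hs⟩

lemma IsNontrivialSCC.typeOne_or_typeTwo {C : Set Q} (h : IsNontrivialSCC M C) :
    IsTypeOne M C ∨ IsTypeTwo M C := by
  by_cases hC : ∃ s ∈ C, ∃ a : Fin b, 0 < (a : ℕ) ∧ M.step s a ∈ C
  · exact .inl ⟨h, hC⟩
  · push Not at hC
    refine .inr ⟨h, fun s hs a ha => ?_⟩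
    by_contra ha'
    exact hC s hs a (Nat.pos_of_ne_zero ha') ha

/-- A type-two component is closed under the digit `0`. -/
lemma IsTypeTwo.step_mem {C : Set Q} (h : IsTypeTwo M C) {z : Fin b} (hz : (z : ℕ) = 0) {s : Q}
    (hs : s ∈ C) : M.step s z ∈ C := by
  obtain ⟨a, ha⟩ := h.1.exists_step_mem hs
  have : a = z := Fin.ext ((h.2 s hs a ha).trans hz.symm)
  exact this ▸ ha

lemma IsTypeTwo.exists_pred_mem {C : Set Q} (h : IsTypeTwo M C) {z : Fin b} (hz : (z : ℕ) = 0)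
    {t : Q} (ht : t ∈ C) : ∃ s ∈ C, M.step s z = t := by
  obtain ⟨s, hs, a, rfl⟩ := h.1.exists_pred_mem ht
  have : a = z := Fin.ext ((h.2 s hs a ht).trans hz.symm)
  exact ⟨s, hs, by rw [this]⟩

/-- In a type-two component, paths are labelled by words `0 ⋯ 0`. -/
lemma IsTypeTwo.exists_iterate_eq {C : Set Q} (h : IsTypeTwo M C) {z : Fin b} (hz : (z : ℕ) = 0)
    {s t : Q} (hs : s ∈ C) (ht : t ∈ C) : ∃ n, (M.step · z)^[n] s = t := by
  have ht' := ht
  rw [h.1.1.eq_scc hs] at ht'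
  obtain ⟨u, hu⟩ := ht'.1
  induction u generalizing s with
  | nil => exact ⟨0, hu⟩
  | cons a u ih =>
    have hmem : M.step s a ∈ C := by
      rw [h.1.1.eq_scc hs]
      exact ⟨.step _ _, Reach.trans ⟨u, hu⟩ ht'.2⟩
    have hC := h.1.1.eq_scc hmem
    obtain ⟨n, hn⟩ := ih hmem (hC ▸ ht) hu
    have ha : a = z := Fin.ext ((h.2 s hs a hmem).trans hz.symm)
    exact ⟨n + 1, by rw [← ha] at hn ⊢; exact hn⟩

variable (M) in
/-- The largest set of states each of which has a predecessor in the set by a digit in `A`. -/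
def IsCore (A : Set (Fin b)) (B : Set Q) : Prop :=
  IsGreatest {B | ∀ t ∈ B, ∃ s ∈ B, ∃ a ∈ A, M.step s a = t} B

lemma image_eq_and_injOn_of_subset_image [Finite Q] {f : Q → Q} {B : Set Q} (h : B ⊆ f '' B) :
    f '' B = B ∧ B.InjOn f := by
  have : f '' B = B := (Set.eq_of_subset_of_ncard_le h (Set.ncard_image_le)).symm
  exact ⟨this, Set.injOn_of_ncard_image_eq (by rw [this])⟩

lemma image_eq_of_mapsTo_of_injOn [Finite Q] {f : Q → Q} {B : Set Q} (h : Set.MapsTo f B B)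
    (hf : B.InjOn f) : f '' B = B :=
  Set.eq_of_subset_of_ncard_le h.image_subset (by rw [hf.ncard_image])

lemma exists_iterate_eq_self [Finite Q] {f : Q → Q} {B : Set Q} (h : Set.MapsTo f B B)
    (hf : B.InjOn f) {s : Q} (hs : s ∈ B) : ∃ n > 0, f^[n] s = s := by
  have hinj : Function.Injective h.restrict := (Set.MapsTo.restrict_inj h).2 hf
  obtain ⟨n, hn, hn'⟩ := hinj.mem_periodicPts ⟨s, hs⟩
  refine ⟨n, hn, ?_⟩
  have h₁ : Function.Semiconj Subtype.val h.restrict f := fun _ => rfl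
  have h₂ := (h₁.iterate_right n) ⟨s, hs⟩
  rw [hn'] at h₂
  exact h₂.symm

variable {a : Fin b} {B : Set Q}

lemma IsCore.image_eq [Finite Q] (h : IsCore M {a} B) : (M.step · a) '' B = B :=
  (image_eq_and_injOn_of_subset_image fun t ht => by simpa using h.1 t ht).1

lemma IsCore.injOn [Finite Q] (h : IsCore M {a} B) : B.InjOn (M.step · a) :=
  (image_eq_and_injOn_of_subset_image fun t ht => by simpa using h.1 t ht).2

lemma IsCore.step_mem [Finite Q] (h : IsCore M {a} B) {s : Q} (hs : s ∈ B) : M.step s a ∈ B :=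
  h.image_eq.subset ⟨s, hs, rfl⟩

lemma IsCore.subset_of_image_eq (h : IsCore M {a} B) {C : Set Q}
    (hC : (M.step · a) '' C = C) : C ⊆ B :=
  h.2 fun t ht => by simpa using hC.superset ht

lemma IsCore.reach_step [Finite Q] (h : IsCore M {a} B) {s : Q} (hs : s ∈ B) :
    Reach M (M.step s a) s := by
  obtain ⟨n, hn, hn'⟩ := exists_iterate_eq_self (f := (M.step · a)) (fun s hs => h.step_mem hs)
    h.injOn hs
  obtain ⟨n, rfl⟩ := Nat.exists_eq_succ_of_ne_zero hn.ne'
  have := reach_iterate (M := M) a n (M.step s a)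
  rwa [show (M.step · a)^[n] (M.step s a) = s from hn'] at this

lemma IsCore.isNontrivialSCC [Finite Q] (h : IsCore M {a} B) {s : Q} (hs : s ∈ B) :
    IsNontrivialSCC M (scc M s) := by
  obtain ⟨u, hu⟩ := h.reach_step hs
  exact isNontrivialSCC_of_circuit (u := a :: u) (by simp) hu

/-- In the largest set closed under predecessors, every state is reached from a circuit. -/
lemma IsCore.exists_circuit [Finite Q] (h : IsCore M Set.univ B) {t : Q} (ht : t ∈ B) :
    ∃ s, IsNontrivialSCC M (scc M s) ∧ Reach M s t := by
  -- Going back from `t` along chosen predecessors, some state is met twice.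
  have : Nonempty (Fin b) := let ⟨_, _, a, _⟩ := h.1 t ht; ⟨a⟩
  choose! g hg a ha using fun t ht => h.1 t ht
  have hmem : ∀ n, g^[n] t ∈ B := fun n => by
    induction n with
    | zero => exact ht
    | succ n ih => rw [Function.iterate_succ_apply']; exact hg _ ih
  have hlast : ∀ n, M.step (g^[n + 1] t) (a (g^[n] t)) = g^[n] t := fun n => by
    rw [Function.iterate_succ_apply']
    exact (ha _ (hmem n)).2
  have hreach : ∀ n k, Reach M (g^[n + k] t) (g^[n] t) := by
    intro n k
    induction k with
    | zero => exact .refl _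
    | succ k ih =>
      refine Reach.trans ⟨[a (g^[n + k] t)], ?_⟩ ih
      exact hlast (n + k)
  obtain ⟨m, n, hmn, heq⟩ : ∃ m n, m < n ∧ g^[m] t = g^[n] t := by
    obtain ⟨m, n, hne, heq⟩ := Finite.exists_ne_map_eq_of_infinite fun n => g^[n] t
    rcases hne.lt_or_gt with h | h
    exacts [⟨m, n, h, heq⟩, ⟨n, m, h, heq.symm⟩]
  obtain ⟨k, rfl⟩ := Nat.exists_eq_add_of_lt hmn
  refine ⟨g^[m] t, ?_, by simpa using hreach 0 m⟩
  obtain ⟨u, hu⟩ := hreach m k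
  refine isNontrivialSCC_of_circuit (u := a (g^[m + k] t) :: u) (by simp) ?_
  rw [heq]
  change M.evalFrom (M.step (g^[m + k + 1] t) (a (g^[m + k] t))) u = _
  rw [hlast, hu, heq]

end SCC

/-! ### UP-atomic automata -/

section Atomic

variable {b : ℕ} {Q : Type*} {M : DFA (Fin b) Q} {S : Set ℕ} {p : ℕ}

lemma hasPurePeriod_iff : HasPurePeriod S p ↔ 0 < p ∧ Function.Periodic (· ∈ S) p := by
  refine and_congr_right fun hp => ⟨?_, fun h => ?_⟩
  · rintro ⟨R, hR, rfl⟩ n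
    refine propext ⟨?_, ?_⟩
    · rintro ⟨r, hr, k, hk⟩
      refine ⟨r, hr, k - 1, ?_⟩
      have hrp := hR r hr
      cases k with
      | zero => omega
      | succ k => rw [Nat.mul_succ] at hk; simp only [Nat.add_sub_cancel]; omega
    · rintro ⟨r, hr, k, rfl⟩
      exact ⟨r, hr, k + 1, by ring⟩
  · refine ⟨{r | r ∈ S ∧ r < p}, fun r hr => hr.2, ?_⟩
    have hmod : ∀ n, (n % p ∈ S) = (n ∈ S) := fun n => h.map_mod_nat n
    ext n
    constructor
    · intro hn
      exact ⟨n % p, ⟨(hmod n).mpr hn, Nat.mod_lt _ hp⟩, n / p, (Nat.mod_add_div n p).symm⟩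
    · rintro ⟨r, ⟨hr, hrp⟩, k, rfl⟩
      rw [← hmod]
      rwa [Nat.add_mul_mod_self_left, Nat.mod_eq_of_lt hrp]

lemma periodic_delta (h : Function.Periodic (· ∈ S) p) (a : Fin b) :
    Function.Periodic (· ∈ Delta S a) p := by
  intro n
  have := (h.nat_mul b) (n * b + a)
  simp only [Delta, Set.mem_ofPred_eq]
  rw [show (n + p) * b + (a : ℕ) = n * b + a + b * p by ring]
  exact this

/-- As `b` is invertible modulo the period, `Δ(S, a)` determines `S`. -/
lemma delta_injective {S' : Set ℕ} (hp : 0 < p) (hpb : p.Coprime b)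
    (h : Function.Periodic (· ∈ S) p) (h' : Function.Periodic (· ∈ S') p) {a : Fin b}
    (heq : Delta S a = Delta S' a) : S = S' := by
  have : NeZero p := ⟨hp.ne'⟩
  ext n
  -- Modulo `p`, every `n` is of the form `m b + a`.
  let m : ℕ := (((n : ZMod p) - (a : ℕ)) * (ZMod.unitOfCoprime b hpb.symm)⁻¹).val
  have hm : (m * b + a) % p = n % p := by
    rw [← ZMod.natCast_eq_natCast_iff']
    have hu : ((ZMod.unitOfCoprime b hpb.symm)⁻¹ : (ZMod p)ˣ) * (b : ZMod p) = 1 := by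
      rw [← ZMod.coe_unitOfCoprime b hpb.symm, Units.inv_mul]
    simp only [m, Nat.cast_add, Nat.cast_mul, ZMod.natCast_val, ZMod.cast_id', id_eq]
    rw [mul_assoc, hu, mul_one, sub_add_cancel]
  have e : ∀ {S : Set ℕ}, Function.Periodic (· ∈ S) p → (n ∈ S ↔ m ∈ Delta S a) := by
    intro S h
    have h₁ : ∀ n, (n % p ∈ S) = (n ∈ S) := fun n => h.map_mod_nat n
    change _ ↔ m * b + a ∈ S
    rw [← h₁ n, ← hm, h₁]
  rw [e h, e h', heq]

/-- On the states of a UP-atomic automaton the digits act injectively, and there is a map `σ`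
(it sends `S` to `S - 1`) in terms of which all digits are expressed through the digit `0`. -/
lemma IsUPAtomic.exists_shift [Finite Q] (h : IsUPAtomic M) {z o : Fin b} (hz : (z : ℕ) = 0)
    (ho : (o : ℕ) = 1) :
    ∃ σ : Q → Q, (∀ s a, M.step s a = M.step (σ^[a] s) z) ∧
      (∀ s, M.step (σ^[b] s) z = σ (M.step s z)) ∧ ∀ a, Function.Injective (M.step · a) := by
  obtain ⟨S, p, hS, hpb, e, -, hstep, -⟩ := h
  obtain ⟨hp, hper⟩ := hasPurePeriod_iff.1 hS.1
  have hper' : ∀ T : {T : Set ℕ // ∃ u : List (Fin b), u.foldl Delta S = T},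
      Function.Periodic (· ∈ T.1) p := by
    rintro ⟨T, u, rfl⟩
    induction u using List.reverseRecOn with
    | nil => exact hper
    | append_singleton u a ih =>
      simp only [List.foldl_append, List.foldl_cons, List.foldl_nil]
      exact periodic_delta ih a
  have hinj : ∀ a, Function.Injective ((setAutomaton b S).step · a) := fun a T T' hT =>
    Subtype.ext (delta_injective hp hpb (hper' T) (hper' T') (congrArg Subtype.val hT))
  have : Finite {T : Set ℕ // ∃ u : List (Fin b), u.foldl Delta S = T} := Finite.of_equiv _ e
  have hsurj := Finite.injective_iff_surjective.1 (hinj z)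
  -- As the digit `0` acts surjectively, the translate of a state is a state.
  have hsh : ∀ T : {T : Set ℕ // ∃ u : List (Fin b), u.foldl Delta S = T},
      ∃ T' : {T : Set ℕ // ∃ u : List (Fin b), u.foldl Delta S = T}, T'.1 = {n | n + 1 ∈ T.1} := by
    intro T
    obtain ⟨T', hT'⟩ := hsurj ((setAutomaton b S).step T o)
    refine ⟨T', delta_injective hp hpb (a := z) (hper' T') ?_ ?_⟩
    · intro n
      have := hper' T (n + 1)
      simp only [Set.mem_ofPred_eq]
      rw [add_right_comm]
      exact this
    · refine (congrArg Subtype.val hT').trans ?_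
      ext n
      simp [setAutomaton, Delta, hz, ho]
  choose sh hsh using hsh
  have hsh' : ∀ n T k, k ∈ (sh^[n] T).1 ↔ k + n ∈ T.1 := by
    intro n
    induction n with
    | zero => simp
    | succ n ih =>
      intro T k
      rw [Function.iterate_succ_apply', hsh, Set.mem_ofPred_eq, ih]
      rw [show k + 1 + n = k + (n + 1) by ring]
  have hiter : ∀ n s, e ((fun s => e.symm (sh (e s)))^[n] s) = sh^[n] (e s) := fun n s => by
    have : Function.Semiconj e (fun s => e.symm (sh (e s))) sh := fun s => by simp
    exact this.iterate_right n s
  refine ⟨fun s => e.symm (sh (e s)), fun s a => ?_, fun s => ?_, fun a s t hst => ?_⟩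
  · apply e.injective
    rw [hstep, hstep, hiter]
    refine Subtype.ext (Set.ext fun n => ?_)
    change n * b + a ∈ (e s).1 ↔ n * b + z ∈ (sh^[a] (e s)).1
    rw [hsh', hz, add_zero]
  · apply e.injective
    rw [hstep, hiter, Equiv.apply_symm_apply, hstep]
    refine Subtype.ext (Set.ext fun n => ?_)
    rw [hsh]
    change n * b + z ∈ (sh^[b] (e s)).1 ↔ (n + 1) * b + z ∈ (e s).1
    rw [hsh', hz, show n * b + 0 + b = (n + 1) * b + 0 by ring]
  · apply e.injective
    apply hinj a
    change (setAutomaton b S).step (e s) a = (setAutomaton b S).step (e t) a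
    rw [← hstep, ← hstep]
    exact congrArg e hst

/-- The converse of `IsUPAtomic.exists_shift` for a closed component: with a bijection `σ` as there,
the state `s` corresponds to the set of all `n` for which the `n`-th iterate of `σ` sends `s` to a
final state. -/
lemma isUPAtomic_restrict [Fintype Q] (hM : IsMinimal M) {z : Fin b} {σ : Q → Q} {C T : Set Q}
    (hC : ∀ s ∈ C, ∀ a, M.step s a ∈ C) (i : C) (hreach : ∀ s ∈ C, Reach M i s) (hCT : C ⊆ T)
    (hT : ∀ s ∈ T, M.step s z ∈ T) (hzT : T.InjOn (M.step · z)) (hσT : Set.MapsTo σ T T)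
    (hσ : T.InjOn σ) (h0 : ∀ s, s ∈ M.accept ↔ M.step s z ∈ M.accept)
    (hstep : ∀ s ∈ T, ∀ a : Fin b, M.step s a = M.step (σ^[a] s) z)
    (hcomm : ∀ s ∈ T, M.step (σ^[b] s) z = σ (M.step s z)) :
    IsUPAtomic (restrict M C hC i) := by
  have hiter : ∀ n, ∀ s ∈ T, σ^[n] s ∈ T := fun n s hs => hσT.iterate n hs
  have hcomm' : ∀ n, ∀ s ∈ T, M.step (σ^[n * b] s) z = σ^[n] (M.step s z) := by
    intro n
    induction n with
    | zero => simp
    | succ n ih =>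
      intro s hs
      rw [Nat.succ_mul, add_comm, Function.iterate_add_apply, hcomm _ (hiter _ _ hs), ih s hs,
        Function.iterate_succ_apply']
  let f : Q → Set ℕ := fun s => {n | σ^[n] s ∈ M.accept}
  have hf : ∀ s ∈ T, ∀ a, Delta (f s) a = f (M.step s a) := by
    intro s hs a
    ext n
    change σ^[n * b + a] s ∈ M.accept ↔ σ^[n] (M.step s a) ∈ M.accept
    rw [Function.iterate_add_apply, h0, hcomm' n _ (hiter _ _ hs), ← hstep s hs]
  have hfold : ∀ (u : List (Fin b)), ∀ s ∈ C, u.foldl Delta (f s) = f (M.evalFrom s u) := by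
    intro u
    induction u with
    | nil => intro s _; rfl
    | cons a u ih =>
      intro s hs
      rw [List.foldl_cons, hf s (hCT hs) a]
      exact ih _ (hC s hs a)
  have hfinj : ∀ s ∈ C, ∀ t ∈ C, f s = f t → s = t := by
    intro s hs t ht hst
    apply hM.acceptsFrom_injective
    ext u
    have e : ∀ s, u ∈ M.acceptsFrom s ↔ 0 ∈ f (M.evalFrom s u) := fun s => Iff.rfl
    rw [e, e, ← hfold u s hs, ← hfold u t ht, hst]
  -- The permutation `σ` of `T` is conjugate to its power with exponent `b`.
  let σ' : Equiv.Perm T := Equiv.ofBijective hσT.restrict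
    (Finite.injective_iff_bijective.1 ((Set.MapsTo.restrict_inj hσT).2 hσ))
  have hzT' : Set.MapsTo (M.step · z) T T := hT
  let z' : Equiv.Perm T := Equiv.ofBijective hzT'.restrict
    (Finite.injective_iff_bijective.1 ((Set.MapsTo.restrict_inj hzT').2 hzT))
  have hpow : ∀ n (s : T), ((σ' ^ n) s : Q) = σ^[n] s := by
    intro n s
    have : Function.Semiconj Subtype.val σ' σ := fun _ => rfl
    rw [← Equiv.Perm.iterate_eq_pow]
    exact this.iterate_right n s
  have hconj : SemiconjBy z' (σ' ^ b) σ' := by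
    ext s
    change M.step ((σ' ^ b) s : T) z = σ (M.step s z)
    rw [hpow, hcomm s s.2]
  have hord : 0 < orderOf σ' := orderOf_pos σ'
  have hcop : (orderOf σ').Coprime b := by
    have h₁ := orderOf_pow (n := b) σ'
    rw [hconj.orderOf_eq] at h₁
    have hdvd := Nat.gcd_dvd_left (orderOf σ') b
    have h₂ := Nat.div_mul_cancel hdvd
    rw [← h₁] at h₂
    exact Nat.eq_of_mul_eq_mul_left hord (h₂.trans (mul_one _).symm)
  have hperσ : Function.Periodic (· ∈ f i) (orderOf σ') := by
    intro n
    change (σ^[n + orderOf σ'] (i : Q) ∈ M.accept) = (σ^[n] (i : Q) ∈ M.accept)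
    have := hpow (orderOf σ') ⟨i, hCT i.2⟩
    rw [pow_orderOf_eq_one] at this
    rw [Function.iterate_add_apply, ← this]
    rfl
  -- The period of `f i` divides the order of `σ`.
  have hex : ∃ p, HasPurePeriod (f i) p := ⟨_, hasPurePeriod_iff.2 ⟨hord, hperσ⟩⟩
  classical
  have hleast : IsLeast {p | HasPurePeriod (f i) p} (Nat.find hex) :=
    ⟨Nat.find_spec hex, fun p hp => Nat.find_min' hex hp⟩
  obtain ⟨hp, hper⟩ := hasPurePeriod_iff.1 hleast.1
  have hdvd : Nat.find hex ∣ orderOf σ' := by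
    rw [Nat.dvd_iff_mod_eq_zero]
    by_contra hmod
    have hper' : Function.Periodic (· ∈ f i) (orderOf σ' % Nat.find hex) := by
      intro n
      have h₁ := (hper.nat_mul (orderOf σ' / Nat.find hex)) (n + orderOf σ' % Nat.find hex)
      have h₂ := Nat.mod_add_div (orderOf σ') (Nat.find hex)
      rw [mul_comm] at h₂
      simp only [Nat.cast_id] at h₁
      rw [add_assoc, h₂] at h₁
      exact h₁.symm.trans (hperσ n)
    exact absurd (hleast.2 (hasPurePeriod_iff.2 ⟨Nat.pos_of_ne_zero hmod, hper'⟩))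
      (not_le.2 (Nat.mod_lt _ hp))
  refine ⟨f i, Nat.find hex, hleast, Nat.Coprime.coprime_dvd_left hdvd hcop, ?_⟩
  have hmem : ∀ s ∈ C, ∃ u : List (Fin b), u.foldl Delta (f i) = f s := by
    intro s hs
    obtain ⟨u, rfl⟩ := hreach s hs
    exact ⟨u, hfold u i i.2⟩
  refine ⟨Equiv.ofBijective (fun s : C => ⟨f s, hmem s s.2⟩) ⟨fun s t hst => ?_, ?_⟩,
    rfl, fun s a => ?_, fun s => Iff.rfl⟩
  · exact Subtype.ext (hfinj s s.2 t t.2 (congrArg Subtype.val hst))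
  · rintro ⟨_, u, rfl⟩
    refine ⟨⟨M.evalFrom i u, Reach.of_closed hC ⟨u, rfl⟩ i.2⟩, Subtype.ext ?_⟩
    exact (hfold u i i.2).symm
  · exact Subtype.ext (hf s (hCT s.2) a).symm

end Atomic

end UPAut

namespace UPAut

/-! ### A local form of the conditions -/

section Local

variable {b : ℕ} {Q : Type*} {M : DFA (Fin b) Q} {z o : Fin b} {Z T R : Set Q} {iz io : Q → Q}

/-- Where it is defined, `I` inverts the restriction to `T` of the action of the digit `a`. -/
def InverseOn (M : DFA (Fin b) Q) (a : Fin b) (T : Set Q) (I : Q → Q) : Prop :=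
  ∀ s ∈ T, I (M.step s a) ∈ T ∧ M.step (I (M.step s a)) a = M.step s a

variable (M z o Z T R iz io) in
/-- Conditions on single states. Here `z` and `o` are the digits `0` and `1`, the set `Z` consists of
the states on circuits labelled by `0`, the set `T` of those on circuits labelled by `1`, and `R` of
those reached from any circuit; `iz` and `io` invert the actions of `z` and `o` on `T`. The map
`fun s => iz (M.step s o)` is the `σ` of `IsUPAtomic.exists_shift`, and the map
`fun s => io (M.step s o)` embeds the components of type two. -/
structure LocalConditions : Prop where
  accept : ∀ s, s ∈ M.accept ↔ M.step s z ∈ M.accept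
  circuits : ∀ s, s ∈ R ↔ s ∈ Z
  one_subset : T ⊆ Z
  step_mem : ∀ s ∈ T, M.step s z ∈ T
  step_eq : ∀ s ∈ T, ∀ a : Fin b, M.step s a = M.step ((fun s => iz (M.step s o))^[a] s) z
  comm : ∀ s ∈ T, M.step ((fun s => iz (M.step s o))^[b] s) z = iz (M.step (M.step s z) o)
  pos_mem : ∀ s ∈ Z, ∀ a : Fin b, 0 < (a : ℕ) → M.step s a ∈ T
  embed_pos : ∀ s ∈ Z, ∀ a : Fin b, 0 < (a : ℕ) → M.step (io (M.step s o)) a = M.step s a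
  embed_zero : ∀ s ∈ Z, io (M.step (M.step s z) o) = M.step (io (M.step s o)) z

lemma InverseOn.eq_of_injOn {a : Fin b} {I : Q → Q} (h : InverseOn M a T I)
    (hT : T.InjOn (M.step · a)) {s : Q} (hs : s ∈ T) : I (M.step s a) = s :=
  hT (h s hs).1 hs (h s hs).2

namespace LocalConditions

variable [Fintype Q] (h : LocalConditions M z o Z T R iz io) (hz : (z : ℕ) = 0)
  (ho : (o : ℕ) = 1) (hZ : IsCore M {z} Z) (hT : IsCore M {o} T) (hR : IsCore M Set.univ R)
  (hiz : InverseOn M z T iz) (hio : InverseOn M o T io)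

include h hZ in
lemma injOn_zero : T.InjOn (M.step · z) := hZ.injOn.mono h.one_subset

include h hZ hT hiz in
/-- The digit `0` permutes `T`, so that its inverse is defined on all of `T`. -/
lemma shift_mem {s : Q} (hs : s ∈ T) :
    iz (M.step s o) ∈ T ∧ M.step (iz (M.step s o)) z = M.step s o := by
  have him := image_eq_of_mapsTo_of_injOn (f := (M.step · z)) h.step_mem (h.injOn_zero hZ)
  obtain ⟨t, ht, hts⟩ := him.superset (hT.step_mem hs)
  change M.step t z = M.step s o at hts
  rw [← hts]
  exact hiz t ht

include h hZ hT hiz in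
lemma shift_injOn : T.InjOn fun s => iz (M.step s o) := by
  intro s hs t ht hst
  apply hT.injOn hs ht
  change M.step s o = M.step t o
  rw [← (h.shift_mem hZ hT hiz hs).2, ← (h.shift_mem hZ hT hiz ht).2]
  exact congrArg (M.step · z) hst

include h hZ hT hiz in
lemma all_step_mem {s : Q} (hs : s ∈ T) (a : Fin b) : M.step s a ∈ T := by
  rw [h.step_eq s hs]
  exact h.step_mem _ (Set.MapsTo.iterate (fun s hs => (h.shift_mem hZ hT hiz hs).1) a hs)

include h hZ hT hiz in
lemma all_injOn (a : Fin b) : T.InjOn (M.step · a) := by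
  have hmaps : Set.MapsTo (fun s => iz (M.step s o)) T T :=
    fun s hs => (h.shift_mem hZ hT hiz hs).1
  have hinj : T.InjOn (fun s => iz (M.step s o))^[a] :=
    (h.shift_injOn hZ hT hiz).iterate hmaps a
  intro s hs t ht hst
  apply hinj hs ht
  apply h.injOn_zero hZ (hmaps.iterate a hs) (hmaps.iterate a ht)
  change M.step _ z = M.step _ z
  rw [← h.step_eq s hs, ← h.step_eq t ht]
  exact hst

include h hZ hT hiz in
/-- The digits permute `T`, so that paths in `T` can be travelled backwards. -/
lemma reach_symm {s t : Q} (hs : s ∈ T) (hst : Reach M s t) : t ∈ T ∧ Reach M t s := by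
  obtain ⟨u, rfl⟩ := hst
  induction u generalizing s with
  | nil => exact ⟨hs, .refl s⟩
  | cons a u ih =>
    obtain ⟨h₁, h₂⟩ := ih (h.all_step_mem hZ hT hiz hs a)
    refine ⟨h₁, h₂.trans ?_⟩
    obtain ⟨n, hn, hn'⟩ := exists_iterate_eq_self (f := (M.step · a))
      (fun s hs => h.all_step_mem hZ hT hiz hs a) (h.all_injOn hZ hT hiz a) hs
    obtain ⟨n, rfl⟩ := Nat.exists_eq_succ_of_ne_zero hn.ne'
    have := reach_iterate (M := M) a n (M.step s a)
    rwa [show (M.step · a)^[n] (M.step s a) = s from hn'] at this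

include h hZ hT hiz in
lemma scc_eq_of_reach {s t : Q} (hs : s ∈ T) (hst : Reach M s t) : scc M s = scc M t :=
  scc_eq hst (h.reach_symm hZ hT hiz hs hst).2

include h hZ hT hiz ho in
lemma isTypeOne_scc {s : Q} (hs : s ∈ T) : IsTypeOne M (scc M s) :=
  ⟨hT.isNontrivialSCC hs, s, mem_scc_self s, o, by omega, .step s o,
    (h.reach_symm hZ hT hiz hs (.step s o)).2⟩

omit [Fintype Q] in
include h hR in
/-- Non-trivial components are closed under predecessors, so they lie in `R`, which is `Z`. -/
lemma subset_of_isNontrivialSCC {C : Set Q} (hC : IsNontrivialSCC M C) : C ⊆ Z := by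
  have hCR : C ⊆ R := hR.2 fun t ht => by
    obtain ⟨s, hs, a, hsa⟩ := hC.exists_pred_mem ht
    exact ⟨s, hs, a, trivial, hsa⟩
  exact fun s hs => (h.circuits s).1 (hCR hs)

include h hZ hT hR hiz in
lemma subset_of_isTypeOne {C : Set Q} (hC : IsTypeOne M C) : C ⊆ T := by
  obtain ⟨s, hs, a, ha, hsa⟩ := hC.2
  have hsT := h.pos_mem s (h.subset_of_isNontrivialSCC hR hC.1 hs) a ha
  intro t ht
  rw [hC.1.1.eq_scc hsa] at ht
  exact (h.reach_symm hZ hT hiz hsT ht.1).1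

include h ho hZ hT hiz in
/-- A state of `T` shares its component with its successor by `1`. -/
lemma disjoint_of_isTypeTwo {C : Set Q} (hC : IsTypeTwo M C) {s : Q} (hs : s ∈ C) : s ∉ T := by
  intro hsT
  have : M.step s o ∈ C := by
    rw [hC.1.1.eq_scc hs]
    exact ⟨.step s o, (h.reach_symm hZ hT hiz hsT (.step s o)).2⟩
  have := hC.2 s hs o this
  omega

include h ho hio in
/-- The digit `1` permutes `T`, so that its inverse is defined at `s · 1`. -/
lemma embed_mem {s : Q} (hs : s ∈ Z) (hT : IsCore M {o} T) : io (M.step s o) ∈ T := by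
  obtain ⟨t, ht, hts⟩ := hT.image_eq.superset (h.pos_mem s hs o (by omega))
  change M.step t o = M.step s o at hts
  rw [← hts]
  exact (hio t ht).1

include h hz ho hZ hT hR hiz hio in
/-- All transitions that leave a type-two component lead to the same component. -/
lemma scc_step_eq {C : Set Q} (hC : IsTypeTwo M C) {s t : Q} (hs : s ∈ C) (ht : t ∈ C)
    {a : Fin b} (ha : 0 < (a : ℕ)) : scc M (M.step t a) = scc M (M.step s o) := by
  have hCZ := h.subset_of_isNontrivialSCC hR hC.1
  have hpos : ∀ s ∈ C, ∀ a : Fin b, 0 < (a : ℕ) →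
      scc M (M.step s a) = scc M (io (M.step s o)) := by
    intro s hs a ha
    rw [← h.embed_pos s (hCZ hs) a ha]
    exact (h.scc_eq_of_reach hZ hT hiz (h.embed_mem ho hio (hCZ hs) hT) (.step _ a)).symm
  rw [hpos t ht a ha, hpos s hs o (by omega)]
  obtain ⟨n, rfl⟩ := hC.exists_iterate_eq hz hs ht
  have hiter : ∀ n, (M.step · z)^[n] s ∈ C ∧ io (M.step ((M.step · z)^[n] s) o) =
      (M.step · z)^[n] (io (M.step s o)) := by
    intro n
    induction n with
    | zero => exact ⟨hs, rfl⟩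
    | succ n ih =>
      rw [Function.iterate_succ_apply', Function.iterate_succ_apply']
      exact ⟨hC.step_mem hz ih.1, by rw [h.embed_zero _ (hCZ ih.1), ih.2]⟩
  rw [(hiter n).2]
  exact (h.scc_eq_of_reach hZ hT hiz (h.embed_mem ho hio (hCZ hs) hT) (reach_iterate z n _)).symm

include h hz ho hZ hT hR hiz hio in
lemma upConditions (hM : IsMinimal M) : UPConditions M where
  up0 s a ha := by
    have : a = z := Fin.ext (ha.trans hz.symm)
    exact this ▸ h.accept s
  up1 := hM
  up2 C hC := by
    have hCT := h.subset_of_isTypeOne hZ hT hR hiz hC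
    have hclosed : ∀ s ∈ C, ∀ a, M.step s a ∈ C := fun s hs a => by
      rw [hC.1.1.eq_scc hs]
      exact ⟨.step s a, (h.reach_symm hZ hT hiz (hCT hs) (.step s a)).2⟩
    obtain ⟨i, hi, -⟩ := hC.2
    refine ⟨hclosed, ⟨i, hi⟩, isUPAtomic_restrict hM hclosed ⟨i, hi⟩ (fun s hs => ?_) hCT
      h.step_mem (h.injOn_zero hZ) (fun s hs => (h.shift_mem hZ hT hiz hs).1)
      (h.shift_injOn hZ hT hiz) h.accept h.step_eq h.comm⟩
    rw [hC.1.1.eq_scc hi] at hs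
    exact hs.1
  up3 C hC := by
    have hCZ := h.subset_of_isNontrivialSCC hR hC.1
    obtain ⟨s, hs, -⟩ := hC.1.2
    have hsT := h.pos_mem s (hCZ hs) o (by omega)
    refine ⟨scc M (M.step s o), ⟨hC.1.1, isSCC_scc _, ?_, s, hs, o, mem_scc_self _⟩,
      h.isTypeOne_scc ho hZ hT hiz hsT, ?_⟩
    · intro heq
      have hmem : M.step s o ∈ C := by rw [heq]; exact mem_scc_self _
      exact h.disjoint_of_isTypeTwo ho hZ hT hiz hC hmem hsT
    · rintro D ⟨-, hD, hne, x, hx, a, hxa⟩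
      rw [hD.eq_scc hxa]
      refine h.scc_step_eq hz ho hZ hT hR hiz hio hC hs hx (Nat.pos_of_ne_zero fun ha => hne ?_)
      have haz : a = z := Fin.ext (ha.trans hz.symm)
      rw [hD.eq_scc hxa, hC.1.1.eq_scc (haz ▸ hC.step_mem hz hx)]
  up4 C D hC := by
    rintro ⟨-, hD, hne, x, hx, a, hxa⟩
    have hCZ := h.subset_of_isNontrivialSCC hR hC.1
    have ha : 0 < (a : ℕ) := Nat.pos_of_ne_zero fun ha => hne <| by
      have haz : a = z := Fin.ext (ha.trans hz.symm)
      rw [hD.eq_scc hxa, hC.1.1.eq_scc (haz ▸ hC.step_mem hz hx)]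
    have hxT := h.pos_mem x (hCZ hx) a ha
    have hDT : D ⊆ T := fun t ht => by
      rw [hD.eq_scc hxa] at ht
      exact (h.reach_symm hZ hT hiz hxT ht.1).1
    have hid : ∀ s ∈ D, io (M.step s o) = s := fun s hs => hio.eq_of_injOn hT.injOn (hDT hs)
    have hZ' : ∀ s ∈ C ∪ D, s ∈ Z := by
      rintro s (hs | hs)
      exacts [hCZ hs, h.one_subset (hDT hs)]
    refine ⟨fun s => io (M.step s o), ?_, hid, ?_⟩
    · rintro s (hs | hs)
      · have hDs : D = scc M (M.step s o) := by
          rw [hD.eq_scc hxa]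
          exact h.scc_step_eq hz ho hZ hT hR hiz hio hC hs hx ha
        have hmem := h.embed_mem ho hio (hCZ hs) hT
        rw [hDs, ← h.embed_pos s (hCZ hs) o (by omega),
          ← h.scc_eq_of_reach hZ hT hiz hmem (.step _ o)]
        exact mem_scc_self _
      · change io (M.step s o) ∈ D
        rwa [hid s hs]
    · intro s hs c hc
      change io (M.step (M.step s c) o) = M.step (io (M.step s o)) c
      rcases Nat.eq_zero_or_pos (c : ℕ) with h0 | hpos
      · have hcz : c = z := Fin.ext (h0.trans hz.symm)
        rw [hcz, h.embed_zero s (hZ' s hs)]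
      · rw [h.embed_pos s (hZ' s hs) c hpos]
        exact hio.eq_of_injOn hT.injOn (h.pos_mem s (hZ' s hs) c hpos)

end LocalConditions

/-- Each state on a circuit labelled by a positive digit is in a component of type one. -/
lemma IsCore.isTypeOne_scc [Finite Q] {a : Fin b} (h : IsCore M {a} T) (ha : 0 < (a : ℕ)) {s : Q}
    (hs : s ∈ T) : IsTypeOne M (scc M s) :=
  ⟨h.isNontrivialSCC hs, s, mem_scc_self s, a, ha, .step s a, h.reach_step hs⟩

lemma UPConditions.localConditions [Fintype Q] (h : UPConditions M) (hz : (z : ℕ) = 0)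
    (ho : (o : ℕ) = 1) (hZ : IsCore M {z} Z) (hT : IsCore M {o} T) (hR : IsCore M Set.univ R)
    (hiz : InverseOn M z T iz) (hio : InverseOn M o T io) :
    LocalConditions M z o Z T R iz io := by
  have ho' : 0 < (o : ℕ) := by omega
  have hinjC : ∀ C, IsTypeOne M C → ∀ a, C.InjOn (M.step · a) := by
    intro C hC a s hs t ht hst
    obtain ⟨hcl, i, hat⟩ := h.up2 C hC
    obtain ⟨-, -, -, hinj⟩ := hat.exists_shift hz ho
    exact congrArg Subtype.val (@hinj a ⟨s, hs⟩ ⟨t, ht⟩ (Subtype.ext hst))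
  have himC : ∀ C, IsTypeOne M C → ∀ a, (M.step · a) '' C = C := by
    intro C hC a
    obtain ⟨hcl, -⟩ := h.up2 C hC
    exact image_eq_of_mapsTo_of_injOn (fun s hs => hcl s hs a) (hinjC C hC a)
  have hCT : ∀ C, IsTypeOne M C → C ⊆ T := fun C hC => hT.subset_of_image_eq (himC C hC o)
  have hCZ : ∀ C, IsTypeOne M C → C ⊆ Z := fun C hC => hZ.subset_of_image_eq (himC C hC z)
  have hTone : ∀ s ∈ T, IsTypeOne M (scc M s) := fun s hs => hT.isTypeOne_scc ho' hs
  have hTZ : T ⊆ Z := fun s hs => hCZ _ (hTone s hs) (mem_scc_self s)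
  have hzT : ∀ s ∈ T, M.step s z ∈ T := fun s hs =>
    hCT _ (hTone s hs) ((h.up2 _ (hTone s hs)).1 s (mem_scc_self s) z)
  have hinjT : T.InjOn (M.step · z) := hZ.injOn.mono hTZ
  -- On a type-one component, the map given by the tables is the shift.
  have hshift : ∀ s ∈ T, (∀ a : Fin b,
      M.step s a = M.step ((fun s => iz (M.step s o))^[a] s) z) ∧
      M.step ((fun s => iz (M.step s o))^[b] s) z = iz (M.step (M.step s z) o) := by
    intro s hs
    have hone := hTone s hs
    obtain ⟨hcl, i, hat⟩ := h.up2 _ hone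
    obtain ⟨σ, hσ, hcomm, -⟩ := hat.exists_shift hz ho
    have hσ' : Function.Semiconj Subtype.val σ fun s => iz (M.step s o) := by
      intro t
      have h₁ : M.step t o = M.step (σ t) z := by
        have := congrArg Subtype.val (hσ t o)
        rw [ho, Function.iterate_one] at this
        exact this
      change (σ t : Q) = iz (M.step t o)
      rw [h₁, hiz.eq_of_injOn hinjT (hCT _ hone (σ t).2)]
    have hiter : ∀ n, (fun s => iz (M.step s o))^[n] s = (σ^[n] ⟨s, mem_scc_self s⟩ : Q) :=
      fun n => ((hσ'.iterate_right n) ⟨s, mem_scc_self s⟩).symm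
    refine ⟨fun a => ?_, ?_⟩
    · rw [hiter]
      exact congrArg Subtype.val (hσ ⟨s, mem_scc_self s⟩ a)
    · rw [hiter]
      exact (congrArg Subtype.val (hcomm ⟨s, mem_scc_self s⟩)).trans (hσ' _)
  have hCZ' : ∀ C, IsTypeTwo M C → C ⊆ Z := by
    intro C hC
    refine hZ.2 fun t ht => ?_
    obtain ⟨s, hs, hst⟩ := hC.exists_pred_mem hz ht
    exact ⟨s, hs, z, rfl, hst⟩
  have htwo : ∀ s ∈ Z, s ∉ T → IsTypeTwo M (scc M s) := fun s hs hsT =>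
    (hZ.isNontrivialSCC hs).typeOne_or_typeTwo.resolve_left
      fun hone => hsT (hCT _ hone (mem_scc_self s))
  -- The transitions by positive digits from a type-two component lead to its descendant.
  have hdesc : ∀ C, IsTypeTwo M C → ∀ s ∈ C, ∀ a : Fin b, 0 < (a : ℕ) →
      IsDescendant M C (scc M (M.step s a)) ∧ IsTypeOne M (scc M (M.step s a)) := by
    intro C hC s hs a ha
    have hd : IsDescendant M C (scc M (M.step s a)) := by
      refine ⟨hC.1.1, isSCC_scc _, fun heq => ?_, s, hs, a, mem_scc_self _⟩
      have hmem : M.step s a ∈ C := by rw [heq]; exact mem_scc_self _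
      have := hC.2 s hs a hmem
      omega
    obtain ⟨D, -, hD, huniq⟩ := h.up3 C hC
    exact ⟨hd, by rw [huniq _ hd]; exact hD⟩
  have hpos : ∀ s ∈ Z, ∀ a : Fin b, 0 < (a : ℕ) → M.step s a ∈ T := by
    intro s hs a ha
    by_cases hsT : s ∈ T
    · exact hCT _ (hTone s hsT) ((h.up2 _ (hTone s hsT)).1 s (mem_scc_self s) a)
    · exact hCT _ (hdesc _ (htwo s hs hsT) s (mem_scc_self s) a ha).2 (mem_scc_self _)
  have hioT : ∀ s ∈ T, io (M.step s o) = s := fun s hs => hio.eq_of_injOn hT.injOn hs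
  have hembed : ∀ s ∈ Z, s ∉ T → (∀ a : Fin b, 0 < (a : ℕ) →
      M.step (io (M.step s o)) a = M.step s a) ∧
      io (M.step (M.step s z) o) = M.step (io (M.step s o)) z := by
    intro s hs hsT
    have hC := htwo s hs hsT
    have hsC := mem_scc_self (M := M) s
    obtain ⟨D, hCD, hD, huniq⟩ := h.up3 _ hC
    obtain ⟨f, hfD, hfid, hf⟩ := h.up4 _ D hC hCD
    have hstepD : ∀ t ∈ scc M s, ∀ a : Fin b, 0 < (a : ℕ) → M.step t a ∈ D := by
      intro t ht a ha
      rw [← huniq _ (hdesc _ hC t ht a ha).1]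
      exact mem_scc_self _
    -- The embedding is determined by its commutation with the digit `1`.
    have hfa : ∀ t ∈ scc M s, ∀ a : Fin b, 0 < (a : ℕ) → M.step (f t) a = M.step t a := by
      intro t ht a ha
      rw [← hf t (.inl ht) a (.inr (hstepD t ht a ha)), hfid _ (hstepD t ht a ha)]
    have hfio : ∀ t ∈ scc M s, io (M.step t o) = f t := by
      intro t ht
      rw [← hfa t ht o ho']
      exact hioT _ (hCT D hD (hfD t (.inl ht)))
    have hsz := hC.step_mem hz hsC
    refine ⟨fun a ha => ?_, ?_⟩
    · rw [hfio s hsC, hfa s hsC a ha]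
    · rw [hfio _ hsz, hfio s hsC, hf s (.inl hsC) z (.inl hsz)]
  refine ⟨fun s => h.up0 s z hz, fun s => ⟨fun hs => ?_, fun hs => ?_⟩, hTZ, hzT,
    fun s hs => (hshift s hs).1, fun s hs => (hshift s hs).2, hpos, fun s hs a ha => ?_,
    fun s hs => ?_⟩
  · obtain ⟨t, ht, hts⟩ := hR.exists_circuit hs
    have hclosed : ∀ s ∈ Z, ∀ a, M.step s a ∈ Z := by
      intro s hs a
      rcases Nat.eq_zero_or_pos (a : ℕ) with h0 | ha
      · have haz : a = z := Fin.ext (h0.trans hz.symm)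
        exact haz ▸ hZ.step_mem hs
      · exact hTZ (hpos s hs a ha)
    refine hts.of_closed hclosed ?_
    rcases ht.typeOne_or_typeTwo with hone | htwo
    exacts [hCZ _ hone (mem_scc_self t), hCZ' _ htwo (mem_scc_self t)]
  · exact hR.2 (fun t ht => by
      obtain ⟨s, hs, a, -, hsa⟩ := hZ.1 t ht
      exact ⟨s, hs, a, trivial, hsa⟩) hs
  · by_cases hsT : s ∈ T
    · rw [hioT s hsT]
    · exact (hembed s hs hsT).1 a ha
  · by_cases hsT : s ∈ T
    · rw [hioT s hsT, hioT _ (hzT s hsT)]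
    · exact (hembed s hs hsT).2

/-- The conditions on components amount to conditions on single states. -/
lemma upConditions_iff_localConditions [Fintype Q] (hM : IsMinimal M) (hz : (z : ℕ) = 0)
    (ho : (o : ℕ) = 1) (hZ : IsCore M {z} Z) (hT : IsCore M {o} T) (hR : IsCore M Set.univ R)
    (hiz : InverseOn M z T iz) (hio : InverseOn M o T io) :
    UPConditions M ↔ LocalConditions M z o Z T R iz io :=
  ⟨fun h => h.localConditions hz ho hZ hT hR hiz hio,
    fun h => h.upConditions hz ho hZ hT hR hiz hio hM⟩

end Local

end UPAut

/-! ### The tables and the automaton -/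

section Bridge

variable {b q : ℕ} {M : DFA (Fin b) (Fin q)} {m : ℕ → ℕ → ℕ}

lemma isCore_of_isGreatest {lo hi : ℕ} {D : ℕ → ℕ}
    (hD : ∀ (s : Fin q) (a : Fin b), D (s * b + a) = M.step s a) (hhi : hi ≤ b) {B : Set ℕ}
    (hB : IsGreatest {B | RAM.Backward b q D lo hi B} B) :
    UPAut.IsCore M {a | lo ≤ (a : ℕ) ∧ (a : ℕ) < hi} {s | (s : ℕ) ∈ B} := by
  constructor
  · intro t ht
    obtain ⟨-, s, hs, a, ha, ha', hsa⟩ := hB.1 _ ht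
    refine ⟨⟨s, (hB.1 _ hs).1⟩, hs, ⟨a, ha'.trans_le hhi⟩, ⟨ha, ha'⟩, Fin.ext ?_⟩
    rw [← hD]
    exact hsa
  · intro C hC t ht
    suffices h : {t | ∃ h : t < q, (⟨t, h⟩ : Fin q) ∈ C} ∈
        {B | RAM.Backward b q D lo hi B} from hB.2 h ⟨t.2, ht⟩
    rintro t ⟨htq, ht⟩
    obtain ⟨s, hs, a, ha, hsa⟩ := hC _ ht
    exact ⟨htq, s, ⟨s.2, hs⟩, a, ha.1, ha.2, by rw [hD, hsa]⟩

lemma inverseOn_of_table {I D : ℕ → ℕ} {B : ℕ → Prop} {a : Fin b}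
    (hD : ∀ (s : Fin q) (a : Fin b), D (s * b + a) = M.step s a)
    (h : RAM.InverseOn b q D a B I) :
    UPAut.InverseOn M a {s | (s : ℕ) < q ∧ B s} (fun j => ⟨I j, h.1 j⟩) := by
  intro s hs
  obtain ⟨h₁, h₂⟩ := h.2 s s.2 hs.2
  rw [hD] at h₁ h₂
  exact ⟨⟨h.1 _, h₁⟩, Fin.ext (by rw [← hD]; exact h₂)⟩

/-- The checks on the tables are the local conditions. -/
lemma checks_iff_localConditions
    (hD : ∀ (s : Fin q) (a : Fin b), m 0 (s * b + a) = M.step s a)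
    (h1 : ∀ s t : Fin q, m 1 s = m 1 t ↔ (s ∈ M.accept ↔ t ∈ M.accept))
    (h6 : ∀ j, m 6 j < q) (h7 : ∀ j, m 7 j < q) {z o : Fin b} (hz : (z : ℕ) = 0)
    (ho : (o : ℕ) = 1) :
    (∀ i < q, (m 1 i = m 1 (m 0 (i * b)) ∧ (m 4 i ≠ 0 ↔ m 2 i ≠ 0)) ∧
      (m 3 i ≠ 0 → RAM.CondOne b m i) ∧ (m 2 i ≠ 0 → RAM.CondZero b m i)) ↔
    UPAut.LocalConditions M z o {s | (s : ℕ) < q ∧ m 2 s ≠ 0} {s | (s : ℕ) < q ∧ m 3 s ≠ 0}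
      {s | (s : ℕ) < q ∧ m 4 s ≠ 0} (fun j => ⟨m 6 j, h6 j⟩) (fun j => ⟨m 7 j, h7 j⟩) := by
  have hDz : ∀ s : Fin q, m 0 (s * b) = M.step s z := fun s => by
    rw [← hD, hz, add_zero]
  have hDo : ∀ s : Fin q, m 0 (s * b + 1) = M.step s o := fun s => by
    rw [← hD, ho]
  have hmem : ∀ (X : ℕ) (s : Fin q), s ∈ {s : Fin q | (s : ℕ) < q ∧ m X s ≠ 0} ↔ m X s ≠ 0 :=
    fun X s => and_iff_right s.2
  let σ : Fin q → Fin q := fun s => ⟨m 6 (M.step s o), h6 _⟩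
  let η : Fin q → Fin q := fun s => ⟨m 7 s, h7 _⟩
  have hσ : ∀ s : Fin q, RAM.shift b m s = σ s := fun s => by
    simp only [RAM.shift, hDo, σ]
  have hσn : ∀ (n : ℕ) (s : Fin q), (RAM.shift b m)^[n] s = σ^[n] s := fun n s => by
    have : Function.Semiconj (Fin.val : Fin q → ℕ) σ (RAM.shift b m) := fun s => (hσ s).symm
    exact ((this.iterate_right n) s).symm
  have hη : ∀ s : Fin q, m 7 s = η s := fun _ => rfl
  have hone : ∀ i : Fin q, RAM.CondOne b m i ↔ m 2 i ≠ 0 ∧ m 3 (M.step i z) ≠ 0 ∧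
      (∀ a : Fin b, M.step i a = M.step (σ^[a] i) z) ∧
      M.step (σ^[b] i) z = σ (M.step i z) := by
    intro i
    simp only [RAM.CondOne, hDz, hσn, hσ, Fin.forall_iff, Fin.ext_iff]
    refine and_congr_right fun _ => and_congr_right fun _ => and_congr_left fun _ =>
      forall₂_congr fun a ha => ?_
    rw [← hD i ⟨a, ha⟩]
  have hzero : ∀ i : Fin q, RAM.CondZero b m i ↔
      η (M.step (M.step i z) o) = M.step (η (M.step i o)) z ∧
      ∀ a : Fin b, 0 < (a : ℕ) → m 3 (M.step i a) ≠ 0 ∧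
        M.step (η (M.step i o)) a = M.step i a := by
    intro i
    simp only [RAM.CondZero, hDz, hDo, hη, Fin.forall_iff, Fin.ext_iff]
    refine and_congr_right fun _ => forall_congr' fun a => ?_
    constructor
    · intro H hab ha
      have := H ha hab
      rwa [← hD i ⟨a, hab⟩, ← hD _ ⟨a, hab⟩]
    · intro H ha hab
      have := H hab ha
      rwa [← hD i ⟨a, hab⟩, ← hD _ ⟨a, hab⟩] at this
  constructor
  · intro H
    have H' := fun i : Fin q => H i i.2
    simp only [hone, hzero, hDz, h1] at H'
    constructor
    · exact fun s => (H' s).1.1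
    · exact fun s => by rw [hmem, hmem]; exact (H' s).1.2
    · exact fun s hs => (hmem 2 s).2 ((H' s).2.1 ((hmem 3 s).1 hs)).1
    · exact fun s hs => (hmem 3 _).2 ((H' s).2.1 ((hmem 3 s).1 hs)).2.1
    · exact fun s hs => ((H' s).2.1 ((hmem 3 s).1 hs)).2.2.1
    · exact fun s hs => ((H' s).2.1 ((hmem 3 s).1 hs)).2.2.2
    · exact fun s hs a ha => (hmem 3 _).2 (((H' s).2.2 ((hmem 2 s).1 hs)).2 a ha).1
    · exact fun s hs a ha => (((H' s).2.2 ((hmem 2 s).1 hs)).2 a ha).2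
    · exact fun s hs => ((H' s).2.2 ((hmem 2 s).1 hs)).1
  · intro H i hi
    have H' : ∀ i : Fin q, (m 1 i = m 1 (m 0 (i * b)) ∧ (m 4 i ≠ 0 ↔ m 2 i ≠ 0)) ∧
        (m 3 i ≠ 0 → RAM.CondOne b m i) ∧ (m 2 i ≠ 0 → RAM.CondZero b m i) := by
      intro i
      simp only [hone, hzero, hDz, h1]
      refine ⟨⟨H.accept i, by rw [← hmem 4 i, ← hmem 2 i]; exact H.circuits i⟩, fun h3 => ?_,
        fun h2 => ?_⟩
      · have h3' := (hmem 3 i).2 h3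
        exact ⟨(hmem 2 i).1 (H.one_subset h3'), (hmem 3 _).1 (H.step_mem i h3'),
          H.step_eq i h3', H.comm i h3'⟩
      · have h2' := (hmem 2 i).2 h2
        exact ⟨H.embed_zero i h2', fun a ha => ⟨(hmem 3 _).1 (H.pos_mem i h2' a ha),
          H.embed_pos i h2' a ha⟩⟩
    exact H' ⟨i, hi⟩

end Bridge

lemma RAM.decideUP_run {W b q : ℕ} {M : DFA (Fin b) (Fin q)} (hb : 1 < b)
    (hW : b * q + 2 ≤ W) (hM : UPAut.IsMinimal M) :
    RAM.Run W RAM.decideUP (RAM.input M) (2000 * (b * q)) fun s =>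
      s.reg 0 ≠ 0 ↔ UPAut.UPConditions M := by
  have hq : 0 < q := M.start.pos
  have hbq : b ≤ b * q := Nat.le_mul_of_pos_right _ hq
  generalize hs : RAM.input M = s
  have hin : ∀ x, 1 < x → s.mem x = fun _ => 0 := by
    intro x hx
    ext j
    simp only [← hs, RAM.input]
    rw [if_neg (by omega), if_neg (by omega)]
  generalize hD₀ : s.mem 0 = D
  have hD : ∀ (t : Fin q) (a : Fin b), D (t * b + a) = M.step t a := by
    intro t a
    have h₁ : ((t : ℕ) * b + a) / b = t := by
      rw [mul_comm, Nat.mul_add_div (by omega), Nat.div_eq_of_lt a.2, add_zero]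
    have h₂ : ((t : ℕ) * b + a) % b = a := by
      rw [mul_comm, Nat.mul_add_mod, Nat.mod_eq_of_lt a.2]
    simp [← hD₀, ← hs, RAM.input, h₁, h₂]
  have hacc : ∀ t u : Fin q, s.mem 1 t = s.mem 1 u ↔ (t ∈ M.accept ↔ u ∈ M.accept) := by
    intro t u
    simp only [← hs, RAM.input]
    by_cases ht : t ∈ M.accept <;> by_cases hu : u ∈ M.accept <;> simp [ht, hu]
  have htab : RAM.Table W b q D := by
    refine ⟨hb, hq, hW, fun i => ?_⟩
    simp only [← hD₀, ← hs, RAM.input, if_true]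
    split_ifs
    exacts [Fin.is_lt _, hq]
  have hl : RAM.Loaded b q D s := ⟨by simp [← hs, RAM.input], by simp [← hs, RAM.input], hD₀⟩
  clear hs
  refine (RAM.Run.seq (T₁ := 300 * (b * q)) (T₂ := 1700 * (b * q)) ?_).time (by omega)
  refine (RAM.peel_run (lo := 0) (hi := 1) htab hl (by simp) (by simp) (by simp [RAM.Exp.Fits,
    RAM.Exp.val, RAM.Exp.cost]) (fun n => ⟨?_, rfl, rfl⟩) (by omega) (by omega)
    (by simp [hin])).mono le_rfl ?_
  · simp only [RAM.Exp.Fits]; omega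
  rintro s₁ ⟨hZ, hr₁, hm₁⟩
  have hl₁ : RAM.Loaded b q D s₁ := hl.of_eq (hr₁ 0 (by simp)) (hr₁ 1 (by simp))
    (hm₁ 0 (by simp) (by simp))
  refine (RAM.Run.seq (T₁ := 300 * (b * q)) (T₂ := 1400 * (b * q)) ?_).time (by omega)
  refine (RAM.peel_run (lo := 1) (hi := 2) htab hl₁ (by simp) (by simp) ⟨?_, rfl, rfl⟩
    (fun n => ⟨?_, rfl, rfl⟩) (by omega) (by omega) ?_).mono le_rfl ?_
  · simp only [RAM.Exp.Fits]; omega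
  · simp only [RAM.Exp.Fits]; omega
  · simp [hm₁, hin]
  rintro s₂ ⟨hT, hr₂, hm₂⟩
  have hl₂ : RAM.Loaded b q D s₂ := hl₁.of_eq (hr₂ 0 (by simp)) (hr₂ 1 (by simp))
    (hm₂ 0 (by simp) (by simp))
  refine (RAM.Run.seq (T₁ := 300 * (b * q)) (T₂ := 1100 * (b * q)) ?_).time (by omega)
  refine (RAM.peel_run (lo := 0) (hi := b) htab hl₂ (by simp) (by simp) (by simp [RAM.Exp.Fits,
    RAM.Exp.val, RAM.Exp.cost]) (fun n => ⟨by trivial, by simpa [RAM.Exp.val] using hl₂.digits,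
    rfl⟩) (by omega) le_rfl ?_).mono le_rfl ?_
  · simp [hm₂, hm₁, hin]
  rintro s₃ ⟨hR, hr₃, hm₃⟩
  have hl₃ : RAM.Loaded b q D s₃ := hl₂.of_eq (hr₃ 0 (by simp)) (hr₃ 1 (by simp))
    (hm₃ 0 (by simp) (by simp))
  refine (RAM.Run.seq (T₁ := 100 * (b * q)) (T₂ := 1000 * (b * q)) ?_).time (by omega)
  refine (RAM.invert_run htab hl₃ ?_ ?_).frame.mono le_rfl ?_
  · simp [hm₃, hm₂, hm₁, hin]
  · simp [hm₃, hm₂, hm₁, hin]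
  rintro s₄ ⟨⟨hi6, hi7⟩, hr₄, hm₄⟩
  have hm₄' : ∀ x < 6, s₄.mem x = s₃.mem x := fun x hx => hm₄ x <| by
    simp [RAM.invert, RAM.Prog.for, RAM.Prog.arrays]
    omega
  have hr₄' : ∀ x < 3, s₄.reg x = s₃.reg x := fun x hx => hr₄ x <| by
    simp [RAM.invert, RAM.Prog.for, RAM.Prog.regs]
    omega
  have hl₄ : RAM.Loaded b q D s₄ := hl₃.of_eq (hr₄' 0 (by simp)) (hr₄' 1 (by simp))
    (hm₄' 0 (by simp))
  have e2 : s₄.mem 2 = s₁.mem 2 := by simp [hm₄', hm₃, hm₂]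
  have e3 : s₃.mem 3 = s₂.mem 3 := by simp [hm₃]
  have e3' : s₄.mem 3 = s₂.mem 3 := by simp [hm₄', hm₃]
  have e4 : s₄.mem 4 = s₃.mem 4 := by simp [hm₄']
  have e1 : s₄.mem 1 = s.mem 1 := by simp [hm₄', hm₃, hm₂, hm₁]
  rw [← e2] at hZ
  rw [← e3'] at hT
  rw [← e4] at hR
  rw [e3, ← e3'] at hi6 hi7
  rw [← e1] at hacc
  generalize hm : s₄.mem = m at *
  have h0 : m 0 = D := hm ▸ hl₄.table
  rw [← h0] at htab hl₄ hD hZ hT hR hi6 hi7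
  refine (RAM.checkAll_run htab hi6.1 hi7.1 hl₄ hm).mono (by omega) ?_
  intro s' hs'
  rw [hs', checks_iff_localConditions hD hacc hi6.1 hi7.1 (z := ⟨0, by omega⟩)
    (o := ⟨1, hb⟩) rfl rfl]
  refine (UPAut.upConditions_iff_localConditions hM rfl rfl ?_ ?_ ?_
    (inverseOn_of_table (a := ⟨0, by omega⟩) hD hi6) (inverseOn_of_table (a := ⟨1, hb⟩) hD hi7)).symm
  · have hA : {a : Fin b | 0 ≤ (a : ℕ) ∧ (a : ℕ) < 1} = {⟨0, by omega⟩} := by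
      ext a
      simp [Fin.ext_iff]
    exact hA ▸ isCore_of_isGreatest hD hb.le hZ
  · have hA : {a : Fin b | 1 ≤ (a : ℕ) ∧ (a : ℕ) < 2} = {⟨1, hb⟩} := by
      ext a
      simp [Fin.ext_iff]
      omega
    exact hA ▸ isCore_of_isGreatest hD hb hT
  · have hA : {a : Fin b | 0 ≤ (a : ℕ) ∧ (a : ℕ) < b} = Set.univ := by
      ext a
      simp
    exact hA ▸ isCore_of_isGreatest hD le_rfl hR

theorem mainTheorem5 :
    ∃ (P : RAM.Prog) (K : ℕ), ∀ (b : ℕ), 1 < b → ∀ (q : ℕ) (M : DFA (Fin b) (Fin q)),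
      UPAut.IsMinimal M →
        ∃ (t : ℕ) (s : RAM.State),
          RAM.Exec ((b * q) ^ K) P (RAM.input M) t s ∧ t ≤ K * (b * q) ∧
            (s.reg 0 ≠ 0 ↔ UPAut.UPConditions M) := by
  have hpow : ∀ K n : ℕ, 2 ≤ K → 2 ≤ n → n + 2 ≤ n ^ K := fun K n hK hn =>
    (by nlinarith : n + 2 ≤ n ^ 2).trans (Nat.pow_le_pow_right (by omega) hK)
  -- The constant is kept abstract, so that the power is not evaluated.
  obtain ⟨K, hK⟩ : ∃ K, K = 2000 := ⟨_, rfl⟩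
  refine ⟨RAM.decideUP, K, fun b hb q M hM => ?_⟩
  have hbq : 2 ≤ b * q := hb.trans_le (Nat.le_mul_of_pos_right _ M.start.pos)
  have := RAM.decideUP_run hb (hpow K _ (by omega) hbq) hM
  rwa [← hK] at this
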